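/- Let $K$ be a field and let $A\in\mathbb Z^{m\times n}$ be an integer matrix with pairwise distinct columns $\mathbf a_1,\dots,\mathbf a_n$. The toric ideal $I_A$ is the kernel of the $K$-algebra homomorphism $K[x_1,\dots,x_n]\to K[t_1^{\pm1},\dots,t_m^{\pm1}]$, $x_j\mapsto T^{\mathbf a_j}$. A binomial is a difference $X^{\mathbf u}-X^{\mathbf v}$ of two distinct monomials, and its support is the set of variables dividing $X^{\mathbf u}$ or $X^{\mathbf v}$. A circuit of $I_A$ is an irreducible binomial $f\in I_A$ such that no binomial in $I_A$ has support properly contained in the support of $f$. Let $d\ge 2$, let $\mathbf e_1,\dots,\mathbf e_d$ be the unit coordinate vectors of $\mathbb Z^d$, and put $$\mathbf A_{d-1}^{(+)}=\{\mathbf 0\}\cup\{\mathbf e_i-\mathbf e_j\mid 1\le i<j\le d\},$$ $$\mathbf B_d^{(+)}=\mathbf A_{d-1}^{(+)}\cup\{\mathbf e_1,\dots,\mathbf e_d\}\cup\{\mathbf e_i+\mathbf e_j\mid 1\le i<j\le d\},$$ $$\mathbf C_d^{(+)}=\mathbf A_{d-1}^{(+)}\cup\{\mathbf e_i+\mathbf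 e_j\mid 1\le i\le j\le d\},$$ $$\mathbf D_d^{(+)}=\mathbf A_{d-1}^{(+)}\cup\{\mathbf e_i+\mathbf e_j\mid 1\le i<j\le d\}.$$ For each of these sets $\Phi^{(+)}$, let $\widetilde\Phi^{(+)}$ be the matrix whose columns are the vectors $\binom{\mathbf v}{1}$, $\mathbf v\in\Phi^{(+)}$, each occurring once. **Corollary.** If $A$ is one of $\widetilde{\mathbf A}_{d-1}^{(+)}$, $\widetilde{\mathbf B}_d^{(+)}$, $\widetilde{\mathbf C}_d^{(+)}$, $\widetilde{\mathbf D}_d^{(+)}$, then $I_A$ is generated by the set of all homogeneous binomials $X^{\mathbf u}-X^{\mathbf v}$ of degree $2$ that are circuits of $I_A$ and for which at least one of $X^{\mathbf u}$, $X^{\mathbf v}$ is squarefree. -/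

import Mathlib

noncomputable section

namespace RootToric

/-! ### Toric ideals and circuits

An integer matrix `A` with row index type `m` and column index type `n` has one variable of the
polynomial ring `MvPolynomial n K` for each of its columns. The Laurent polynomial ring over `K` in
variables indexed by `m` is the group algebra `AddMonoidAlgebra K (m → ℤ)`, in which
`AddMonoidAlgebra.single a 1` is the Laurent monomial `T ^ a`. -/

/-- The homomorphism `x_j ↦ T ^ (a_j)`, where `a_j` is the `j`-th column of `A`. Its range is the
toric ring `K[A]`. -/
def toricMap (K : Type*) [Field K] {m n : Type*} (A : Matrix m n ℤ) :
    MvPolynomial n K →ₐ[K] AddMonoidAlgebra K (m → ℤ) :=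
  MvPolynomial.aeval fun j => AddMonoidAlgebra.single (A.col j) (1 : K)

/-- The toric ideal `I_A`. -/
def toricIdeal (K : Type*) [Field K] {m n : Type*} (A : Matrix m n ℤ) :
    Ideal (MvPolynomial n K) :=
  RingHom.ker (toricMap K A)

/-- A binomial: a difference of two distinct monomials. -/
def IsBinomial {K : Type*} [Field K] {n : Type*} (f : MvPolynomial n K) : Prop :=
  ∃ u v : n →₀ ℕ, u ≠ v ∧ f = MvPolynomial.monomial u 1 - MvPolynomial.monomial v 1

/-- The set `C_A` of circuits of `I_A`: irreducible binomials of `I_A` such that no binomial of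
`I_A` has strictly smaller support. The support of a binomial is its set of variables. -/
def circuits (K : Type*) [Field K] {m n : Type*} (A : Matrix m n ℤ) : Set (MvPolynomial n K) :=
  {f | f ∈ toricIdeal K A ∧ IsBinomial f ∧ Irreducible f ∧
    ¬ ∃ g ∈ toricIdeal K A, IsBinomial g ∧ g.vars ⊂ f.vars}

/-- The set of circuits `X ^ u - X ^ v` such that `X ^ u` or `X ^ v` is squarefree. -/
def squarefreeCircuits (K : Type*) [Field K] {m n : Type*} (A : Matrix m n ℤ) :
    Set (MvPolynomial n K) :=
  {f | f ∈ circuits K A ∧ ∃ u v : n →₀ ℕ,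
    f = MvPolynomial.monomial u 1 - MvPolynomial.monomial v 1 ∧
    (Squarefree (MvPolynomial.monomial u (1 : K)) ∨
      Squarefree (MvPolynomial.monomial v (1 : K)))}

/-! ### The configurations of positive roots -/

/-- The `i`-th unit coordinate vector of `ℤ ^ d`. -/
abbrev e {d : ℕ} (i : Fin d) : Fin d → ℤ := Pi.single i 1

/-- The origin together with the positive roots of type `A_{d-1}`. -/
def posA (d : ℕ) : Set (Fin d → ℤ) :=
  {0} ∪ {x | ∃ i j : Fin d, i < j ∧ x = e i - e j}

/-- The origin together with the positive roots of type `B_d`. -/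
def posB (d : ℕ) : Set (Fin d → ℤ) :=
  posA d ∪ {x | ∃ i : Fin d, x = e i} ∪ {x | ∃ i j : Fin d, i < j ∧ x = e i + e j}

/-- The origin together with the positive roots of type `C_d`. -/
def posC (d : ℕ) : Set (Fin d → ℤ) :=
  posA d ∪ {x | ∃ i j : Fin d, i ≤ j ∧ x = e i + e j}

/-- The origin together with the positive roots of type `D_d`. -/
def posD (d : ℕ) : Set (Fin d → ℤ) :=
  posA d ∪ {x | ∃ i j : Fin d, i < j ∧ x = e i + e j}

/-- The matrix whose columns are the elements of `Φ`, each listed once. -/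
def columnMatrix {d : ℕ} (Φ : Set (Fin d → ℤ)) : Matrix (Fin d) Φ ℤ :=
  Matrix.of fun i x => (x : Fin d → ℤ) i

/-- The matrix whose columns are the elements of `Φ`, with a row of ones appended below. -/
def tilde {d : ℕ} (Φ : Set (Fin d → ℤ)) : Matrix (Fin d ⊕ Unit) Φ ℤ :=
  Matrix.fromRows (columnMatrix Φ) (Matrix.of fun _ _ => 1)

end RootToric

end

namespace RootToric

/-! ### Quadratic moves on multisets -/

section Moves

variable {M : Type*} [AddCommGroup M] {Φ : Set M}

/-! A monomial is a multiset of vectors of `Φ`. Two monomials agree modulo the toric ideal exactly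
when their multisets have equal sum and, by the row of ones, equal cardinality; such differences
generate the ideal (`toricIdeal_le`). Replacing two vectors by two others with the same sum changes
the monomial by a multiple of a quadric (`Conn.prod_sub_mem_span`). So two facts suffice: these
moves connect every fiber (`conn_config`), and each nonzero quadric is, up to sign, a squarefree
circuit (`monomial_pair_sub_mem_quadraticCircuits`).

Connectivity goes by induction on the cardinality N: find a vector reachable from both multisets
(`exists_common`) and cancel it. The candidate is read off the common sum s. If s has negative
coordinates, let n be the first of them and m the last positive one before n; the candidate is e_m -
e_n. Otherwise it is 0, unless the coordinates of s add up to at least 2N - 1, where only vectors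
e_i and e_i + e_j occur and these can be matched directly. The basic exchange is (e_a + z) + (e_p +
y) = (e_p + z) + (e_a + y). The choice of indices leaves one obstruction, y = e_a when 2e_a is not
available. A third vector removes it unless every vector has a-th coordinate 1, a condition visible
in s and N and treated separately. Types B, C, D are handled together; type A is the face of D on
which the coordinate sum vanishes.

For the circuits: four distinct points of the configuration with x + y = z + w are not collinear
(`eq_zero_of_smul_add_smul_eq_zero`). Hence every affine relation among them is a multiple of the
given one, and none has smaller support. -/

/-- The equivalence relation on multisets generated by replacing two elements of `Φ` by two
elements of `Φ` with the same sum. -/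
inductive Conn (Φ : Set M) : Multiset M → Multiset M → Prop
  | refl (U : Multiset M) : Conn Φ U U
  | step {a b c d : M} (W : Multiset M) : a ∈ Φ → b ∈ Φ → c ∈ Φ → d ∈ Φ → a + b = c + d →
      Conn Φ (a ::ₘ b ::ₘ W) (c ::ₘ d ::ₘ W)
  | trans {U V W : Multiset M} : Conn Φ U V → Conn Φ V W → Conn Φ U W

theorem Conn.symm {U V : Multiset M} (h : Conn Φ U V) : Conn Φ V U := by
  induction h with
  | refl U => exact .refl U
  | step W ha hb hc hd hs => exact .step W hc hd ha hb hs.symm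
  | trans _ _ h1 h2 => exact h2.trans h1

theorem Conn.cons {U V : Multiset M} (h : Conn Φ U V) (x : M) :
    Conn Φ (x ::ₘ U) (x ::ₘ V) := by
  induction h with
  | refl U => exact .refl _
  | @step a b c d W ha hb hc hd hs =>
    have h := Conn.step (x ::ₘ W) ha hb hc hd hs
    have e1 : ∀ a b : M, a ::ₘ b ::ₘ x ::ₘ W = x ::ₘ a ::ₘ b ::ₘ W := fun a b => by
      simp only [← Multiset.singleton_add]; abel
    rwa [e1, e1] at h
  | trans _ _ h1 h2 => exact h1.trans h2

theorem Conn.sum_eq {U V : Multiset M} (h : Conn Φ U V) : U.sum = V.sum := by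
  induction h with
  | refl U => rfl
  | step W ha hb hc hd hs => simp only [Multiset.sum_cons, ← add_assoc, hs]
  | trans _ _ h1 h2 => exact h1.trans h2

theorem Conn.card_eq {U V : Multiset M} (h : Conn Φ U V) : U.card = V.card := by
  induction h with
  | refl U => rfl
  | step W ha hb hc hd hs => simp
  | trans _ _ h1 h2 => exact h1.trans h2

theorem Conn.subset {U V : Multiset M} (h : Conn Φ U V) (hU : ∀ x ∈ U, x ∈ Φ) :
    ∀ x ∈ V, x ∈ Φ := by
  induction h with
  | refl U => exact hU
  | step W ha hb hc hd hs =>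
    intro x hx
    simp only [Multiset.mem_cons] at hx hU
    rcases hx with rfl | rfl | hx
    · exact hc
    · exact hd
    · exact hU x (Or.inr (Or.inr hx))
  | trans _ _ h1 h2 => exact h2 (h1 hU)

/-- `x` occurs in some multiset that is connected to `U`. -/
def Reach (Φ : Set M) (U : Multiset M) (x : M) : Prop := ∃ W, Conn Φ U (x ::ₘ W)

theorem Reach.of_mem {U : Multiset M} {x : M} (h : x ∈ U) : Reach Φ U x := by
  obtain ⟨W, rfl⟩ := Multiset.exists_cons_of_mem h
  exact ⟨W, .refl _⟩

theorem Conn.reach {U V : Multiset M} {x : M} (h : Conn Φ U V) (hV : Reach Φ V x) :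
    Reach Φ U x := by
  obtain ⟨W, hW⟩ := hV
  exact ⟨W, h.trans hW⟩

/-- The unit from which chains of exchanges are built: one move, after which membership in `Φ` is
again available for the next one. -/
theorem Reach.via {U : Multiset M} {a b x : M} (c d : M) (W : Multiset M)
    (hU : ∀ x ∈ U, x ∈ Φ) (h : U = a ::ₘ b ::ₘ W) (hc : c ∈ Φ) (hd : d ∈ Φ)
    (hs : a + b = c + d)
    (hr : (∀ x ∈ c ::ₘ d ::ₘ W, x ∈ Φ) → Reach Φ (c ::ₘ d ::ₘ W) x) : Reach Φ U x := by
  subst h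
  have h : Conn Φ (a ::ₘ b ::ₘ W) (c ::ₘ d ::ₘ W) :=
    .step W (hU _ (by simp)) (hU _ (by simp)) hc hd hs
  exact h.reach (hr (h.subset hU))

theorem Reach.swap {U : Multiset M} {a b : M} (c d : M) (W : Multiset M)
    (hU : ∀ x ∈ U, x ∈ Φ) (h : U = a ::ₘ b ::ₘ W) (hc : c ∈ Φ) (hd : d ∈ Φ)
    (hs : a + b = c + d) : Reach Φ U c :=
  Reach.via c d W hU h hc hd hs fun _ => .of_mem (by simp)

theorem exists_mem_pos_of_sum_pos (f : M →+ ℤ) (U : Multiset M) (h : 0 < f U.sum) :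
    ∃ x ∈ U, 0 < f x := by
  induction U using Multiset.induction with
  | empty => simp at h
  | cons a s ih =>
    rw [Multiset.sum_cons, map_add] at h
    by_cases ha : 0 < f a
    · exact ⟨a, by simp, ha⟩
    · obtain ⟨x, hx, hx'⟩ := ih (by omega)
      exact ⟨x, by simp [hx], hx'⟩

theorem sum_le_of_forall_le (f : M →+ ℤ) (m : ℤ) (U : Multiset M) (h : ∀ x ∈ U, f x ≤ m) :
    f U.sum ≤ m * U.card := by
  induction U using Multiset.induction with
  | empty => simp
  | cons a s ih =>
    rw [Multiset.sum_cons, map_add, Multiset.card_cons]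
    have := h a (by simp)
    have := ih fun x hx => h x (by simp [hx])
    push_cast
    linarith

theorem sum_eq_of_forall_eq (f : M →+ ℤ) (m : ℤ) (U : Multiset M) (h : ∀ x ∈ U, f x = m) :
    f U.sum = m * U.card := by
  have h1 := sum_le_of_forall_le f m U fun x hx => (h x hx).le
  have h2 := sum_le_of_forall_le (-f) (-m) U fun x hx => by simp [h x hx]
  simp only [AddMonoidHom.neg_apply] at h2
  linarith

theorem forall_eq_of_sum_eq (f : M →+ ℤ) (m : ℤ) (U : Multiset M) (h : ∀ x ∈ U, f x ≤ m)
    (hs : f U.sum = m * U.card) : ∀ x ∈ U, f x = m := by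
  intro x hx
  obtain ⟨W, rfl⟩ := Multiset.exists_cons_of_mem hx
  have h1 := sum_le_of_forall_le f m W fun x hx => h x (by simp [hx])
  have h2 := h x hx
  rw [Multiset.sum_cons, map_add, Multiset.card_cons] at hs
  push_cast at hs
  linarith

theorem exists_mem_lt_of_sum_lt (f : M →+ ℤ) (m : ℤ) (U : Multiset M)
    (h : f U.sum < m * U.card) : ∃ x ∈ U, f x < m := by
  by_contra! hc
  have h2 := sum_le_of_forall_le (-f) (-m) U fun x hx => by simpa using hc x hx
  simp only [AddMonoidHom.neg_apply] at h2
  linarith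

end Moves

/-! ### Coordinates -/

section Coordinates

variable {d : ℕ}

theorem exists_mem_pos (p : Fin d) (U : Multiset (Fin d → ℤ)) (h : 0 < U.sum p) :
    ∃ x ∈ U, 0 < x p :=
  exists_mem_pos_of_sum_pos (Pi.evalAddMonoidHom (fun _ => ℤ) p) U h

theorem exists_mem_neg (p : Fin d) (U : Multiset (Fin d → ℤ)) (h : U.sum p < 0) :
    ∃ x ∈ U, x p < 0 := by
  obtain ⟨x, hx, h⟩ := exists_mem_pos_of_sum_pos (-Pi.evalAddMonoidHom (fun _ => ℤ) p) U
    (by simpa using h)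
  exact ⟨x, hx, by simpa using h⟩

theorem sum_apply_eq_card (p : Fin d) (U : Multiset (Fin d → ℤ)) (h : ∀ x ∈ U, x p = 1) :
    U.sum p = U.card := by
  simpa using sum_eq_of_forall_eq (Pi.evalAddMonoidHom (fun _ => ℤ) p) 1 U h

/-- Makes "every vector has coordinate 1 at `p`" a property of sum and cardinality alone, so that it
passes between multisets of the same fiber. -/
theorem forall_apply_eq_one (p : Fin d) (U : Multiset (Fin d → ℤ)) (h : ∀ x ∈ U, x p ≤ 1)
    (hs : U.sum p = U.card) : ∀ x ∈ U, x p = 1 :=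
  forall_eq_of_sum_eq (Pi.evalAddMonoidHom (fun _ => ℤ) p) 1 U h (by simpa using hs)

/-- The sum of the coordinates. -/
def coordSum (d : ℕ) : (Fin d → ℤ) →+ ℤ where
  toFun x := ∑ i, x i
  map_zero' := by simp
  map_add' x y := by simp [Finset.sum_add_distrib]

@[simp] theorem coordSum_e (i : Fin d) : coordSum d (e i) = 1 := by
  simp [coordSum]

theorem e_self (i : Fin d) : e i i = 1 := by simp

theorem e_ne {i j : Fin d} (h : j ≠ i) : e i j = 0 := by simp [h]

theorem e_nonneg (i j : Fin d) : 0 ≤ e i j := by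
  by_cases h : j = i
  · subst h; simp
  · rw [e_ne h]

end Coordinates

/-! ### The configurations with optional vectors `e i` and `e i + e i` -/

section Config

variable {d : ℕ} {b c : Prop}

/-- The configuration of type `D`, together with the vectors `e i` if `b` holds and with the
vectors `e i + e i` if `c` holds. -/
def config (b c : Prop) (d : ℕ) : Set (Fin d → ℤ) :=
  posD d ∪ {x | b ∧ ∃ i : Fin d, x = e i} ∪ {x | c ∧ ∃ i : Fin d, x = e i + e i}

/-- The vectors `y` that complete `e a` to an element `e a + y` of the configuration. -/
inductive Tail (b c : Prop) {d : ℕ} (a : Fin d) : (Fin d → ℤ) → Prop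
  | zero : b → Tail b c a 0
  | pos (q : Fin d) : q ≠ a ∨ c → Tail b c a (e q)
  | neg (q : Fin d) : a < q → Tail b c a (-e q)

theorem zero_mem_config : (0 : Fin d → ℤ) ∈ config b c d := by
  simp [config, posD, posA]

theorem Tail.mem {a : Fin d} {y : Fin d → ℤ} (h : Tail b c a y) : e a + y ∈ config b c d := by
  cases h with
  | zero hb => exact Or.inl (Or.inr ⟨hb, a, by simp⟩)
  | pos q hq =>
    by_cases h : q = a
    · subst h
      exact Or.inr ⟨by simpa using hq, q, rfl⟩
    · rcases lt_or_gt_of_ne h with h | h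
      · exact Or.inl (Or.inl (Or.inr ⟨q, a, h, add_comm _ _⟩))
      · exact Or.inl (Or.inl (Or.inr ⟨a, q, h, rfl⟩))
  | neg q hq => exact Or.inl (Or.inl (Or.inl (Or.inr ⟨a, q, hq, by abel⟩)))

theorem config_cases {x : Fin d → ℤ} (h : x ∈ config b c d) :
    x = 0 ∨ ∃ a y, Tail b c a y ∧ x = e a + y := by
  rcases h with ((((rfl | ⟨i, j, h, rfl⟩) | ⟨i, j, h, rfl⟩) | ⟨hb, i, rfl⟩) | ⟨hc, i, rfl⟩)
  · exact Or.inl rfl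
  · exact Or.inr ⟨i, _, .neg j h, by abel⟩
  · exact Or.inr ⟨i, _, .pos j (Or.inl h.ne'), rfl⟩
  · exact Or.inr ⟨i, _, .zero hb, by simp⟩
  · exact Or.inr ⟨i, _, .pos i (Or.inr hc), rfl⟩

theorem e_add_e_mem {i j : Fin d} (h : i ≠ j) : e i + e j ∈ config b c d :=
  (Tail.pos j (Or.inl h.symm)).mem

theorem e_sub_e_mem {i j : Fin d} (h : i < j) : e i + -e j ∈ config b c d :=
  (Tail.neg j h).mem

theorem e_mem (hb : b) (i : Fin d) : e i ∈ config b c d := by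
  simpa using (Tail.zero (c := c) (a := i) hb).mem

theorem eq_of_apply_neg {x : Fin d → ℤ} (hx : x ∈ config b c d) {n : Fin d} (h : x n < 0) :
    ∃ p < n, x = e p + -e n := by
  rcases config_cases hx with rfl | ⟨a, y, hy, rfl⟩
  · simp at h
  have ha := e_nonneg a n
  cases hy with
  | zero => simp only [Pi.add_apply, Pi.zero_apply] at h; omega
  | pos q =>
    have hq := e_nonneg q n
    simp only [Pi.add_apply] at h
    omega
  | neg q hq =>
    by_cases hn : n = q
    · subst hn; exact ⟨a, hq, rfl⟩
    · simp only [Pi.add_apply, Pi.neg_apply, e_ne hn] at h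
      omega

/-- Normal form for exchanges: the positive coordinate can be made the leading one, turning e_a +
e_p around if necessary. -/
theorem eq_of_apply_pos {x : Fin d → ℤ} (hx : x ∈ config b c d) {p : Fin d} (h : 0 < x p) :
    ∃ y, Tail b c p y ∧ x = e p + y := by
  rcases config_cases hx with rfl | ⟨a, y, hy, rfl⟩
  · simp at h
  by_cases hpa : p = a
  · subst hpa; exact ⟨y, hy, rfl⟩
  simp only [Pi.add_apply, e_ne hpa] at h
  cases hy with
  | zero => simp at h
  | pos q hq =>
    by_cases hn : p = q
    · subst hn; exact ⟨e a, .pos a (Or.inl (Ne.symm hpa)), add_comm _ _⟩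
    · simp [e_ne hn] at h
  | neg q hq =>
    have := e_nonneg q p
    simp only [Pi.neg_apply] at h
    omega

theorem Tail.apply_self (hc : ¬ c) {p : Fin d} {y : Fin d → ℤ} (h : Tail b c p y) : y p = 0 := by
  cases h with
  | zero => rfl
  | pos q hq => exact e_ne ((hq.resolve_right hc).symm)
  | neg q hq => rw [Pi.neg_apply, e_ne hq.ne, neg_zero]

theorem apply_le_one (hc : ¬ c) {x : Fin d → ℤ} (hx : x ∈ config b c d) (p : Fin d) :
    x p ≤ 1 := by
  by_contra! h
  obtain ⟨y, hy, rfl⟩ := eq_of_apply_pos hx (p := p) (by omega)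
  rw [Pi.add_apply, hy.apply_self hc, e_self] at h
  omega

theorem eq_of_apply_pos_pos {x : Fin d → ℤ} (hx : x ∈ config b c d) {i q : Fin d} (hiq : q ≠ i)
    (hi : 0 < x i) (hq : 0 < x q) : x = e i + e q := by
  obtain ⟨y, hy, rfl⟩ := eq_of_apply_pos hx hi
  rw [Pi.add_apply, e_ne hiq] at hq
  cases hy with
  | zero => simp at hq
  | pos r hr =>
    by_cases h : q = r
    · rw [h]
    · simp [e_ne h] at hq
  | neg r hr =>
    have := e_nonneg r q
    simp only [Pi.neg_apply] at hq
    omega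

/-- The obstructions to replacing `e a` by `e p` in an element `e a + y`. -/
theorem Tail.cases_of_not {a p : Fin d} {y : Fin d → ℤ} (h : Tail b c a y)
    (hn : ¬ Tail b c p y) : (y = e p ∧ ¬ c) ∨ ∃ q, q ≤ p ∧ a < q ∧ y = -e q := by
  cases h with
  | zero hb => exact absurd (.zero hb) hn
  | pos q hq =>
    left
    by_cases hqp : q = p
    · subst hqp
      exact ⟨rfl, fun hc => hn (.pos q (Or.inr hc))⟩
    · exact absurd (.pos q (Or.inl hqp)) hn
  | neg q hq =>
    right
    exact ⟨q, not_lt.1 fun h => hn (.neg q h), hq, rfl⟩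

theorem coordSum_le_two {x : Fin d → ℤ} (hx : x ∈ config b c d) : coordSum d x ≤ 2 := by
  rcases config_cases hx with rfl | ⟨a, y, hy, rfl⟩
  · simp
  · cases hy <;> simp

/-- Exchange `e a` and `e p` in the presence of `e p + e a` by means of a third element. -/
theorem Reach.rotate {U W : Multiset (Fin d → ℤ)} {a p r : Fin d} {y z : Fin d → ℤ}
    (hU : ∀ x ∈ U, x ∈ config b c d)
    (h : U = (e a + z) ::ₘ (e p + e a) ::ₘ (e r + y) ::ₘ W) (hra : r ≠ a)
    (hy : Tail b c a y) (hz : e p + z ∈ config b c d) : Reach (config b c d) U (e p + z) := by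
  by_cases hrp : r = p
  · subst hrp
    refine Reach.swap (a := e a + z) (b := e r + y) _ (e a + y) ((e r + e a) ::ₘ W) hU ?_ hz hy.mem
      (by abel)
    rw [h, Multiset.cons_swap (e r + e a)]
  · refine Reach.via (a := e p + e a) (b := e r + y) (e p + e r) (e a + y) ((e a + z) ::ₘ W) hU ?_
      (e_add_e_mem (Ne.symm hrp)) hy.mem (by abel) fun hU' => ?_
    · rw [h]; simp only [← Multiset.singleton_add]; abel
    · refine Reach.swap (a := e p + e r) (b := e a + z) _ (e r + e a) ((e a + y) ::ₘ W) hU' ?_ hz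
        (e_add_e_mem hra) (by abel)
      rw [Multiset.cons_swap (e a + y)]

end Config

end RootToric

namespace RootToric

section Connectivity

variable {d : ℕ} {b c : Prop}

/-! ### Fibers with a negative coordinate -/

theorem Reach.of_zero {U : Multiset (Fin d → ℤ)} {p m n : Fin d}
    (hU : ∀ x ∈ U, x ∈ config b c d) (hpm : p < m) (hmn : m < n) (h0 : 0 ∈ U)
    (hE : e p + -e n ∈ U) : Reach (config b c d) U (e m + -e n) := by
  obtain ⟨W, rfl⟩ := Multiset.exists_cons_of_mem h0
  have hne : e p + -e n ≠ 0 := fun h => by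
    have := congrFun h p
    rw [Pi.add_apply, Pi.neg_apply, e_self, e_ne (hpm.trans hmn).ne] at this
    simp at this
  obtain ⟨W', rfl⟩ := Multiset.exists_cons_of_mem ((Multiset.mem_cons.1 hE).resolve_left hne)
  exact Reach.swap _ (e p + -e m) W' hU rfl (e_sub_e_mem hmn) (e_sub_e_mem hpm) (by abel)

/-- The coordinate 1 at `p` must be compensated by some e_q - e_p, and (e_p - e_n) + (e_q - e_p) =
(e_q - e_n) + 0. -/
theorem exists_lt_reach {U : Multiset (Fin d → ℤ)} {p n : Fin d}
    (hU : ∀ x ∈ U, x ∈ config b c d) (hpn : p < n) (hr : Reach (config b c d) U (e p + -e n))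
    (hp : U.sum p ≤ 0) : ∃ q < p, Reach (config b c d) U (e q + -e n) := by
  obtain ⟨W, hW⟩ := hr
  have hs := congrFun hW.sum_eq p
  rw [Multiset.sum_cons, Pi.add_apply, Pi.add_apply, Pi.neg_apply, e_self, e_ne hpn.ne] at hs
  have hV := hW.subset hU
  obtain ⟨x, hx, hxp⟩ := exists_mem_neg p W (by omega)
  obtain ⟨q, hq, rfl⟩ := eq_of_apply_neg (hV x (by simp [hx])) hxp
  obtain ⟨W', rfl⟩ := Multiset.exists_cons_of_mem hx
  exact ⟨q, hq, hW.reach (Reach.swap _ 0 W' hV rfl (e_sub_e_mem (hq.trans hpn)) zero_mem_config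
    (by abel))⟩

/-- Exchange e_p and e_m between e_p - e_n and a vector e_m + y. This fails only for y = e_p without
2e_p; then a third vector `f` whose coordinate at `p` is not 1 helps. -/
theorem reach_or_forall_eq_one {U : Multiset (Fin d → ℤ)} {p m n : Fin d}
    (hU : ∀ x ∈ U, x ∈ config b c d) (hpm : p < m) (hmn : m < n)
    (hE : e p + -e n ∈ U) (hm : 0 < U.sum m) (hpos : ∀ q < n, 0 ≤ U.sum q)
    (hmin : ∀ q < p, ¬ Reach (config b c d) U (e q + -e n)) :
    Reach (config b c d) U (e m + -e n) ∨ (¬ c ∧ ∀ x ∈ U, x p = 1) := by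
  obtain ⟨U, rfl⟩ := Multiset.exists_cons_of_mem hE
  have hpn := hpm.trans hmn
  rw [Multiset.sum_cons, Pi.add_apply, Pi.add_apply, Pi.neg_apply, e_ne hpm.ne', e_ne hmn.ne] at hm
  obtain ⟨g, hg, hgm⟩ := exists_mem_pos m U (by omega)
  obtain ⟨y, hy, rfl⟩ := eq_of_apply_pos (hU g (by simp [hg])) hgm
  obtain ⟨W, rfl⟩ := Multiset.exists_cons_of_mem hg
  by_cases hpy : Tail b c p y
  · exact Or.inl (Reach.swap _ (e p + y) W hU rfl (e_sub_e_mem hmn) hpy.mem (by abel))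
  rcases hy.cases_of_not hpy with ⟨rfl, hc⟩ | ⟨q, hq, hq', rfl⟩
  swap
  · exact absurd (hpm.trans hq') (not_lt.2 hq)
  by_contra! hcon
  obtain ⟨hnr, hcon⟩ := hcon
  obtain ⟨f, hf, hfp⟩ := hcon hc
  have hfW : f ∈ W := by
    simp only [Multiset.mem_cons] at hf
    rcases hf with rfl | rfl | hf
    · rw [Pi.add_apply, Pi.neg_apply, e_self, e_ne hpn.ne] at hfp
      simp at hfp
    · rw [Pi.add_apply, e_self, e_ne hpm.ne] at hfp
      simp at hfp
    · exact hf
  rcases config_cases (hU f hf) with rfl | ⟨a, y, hya, rfl⟩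
  · exact hnr (Reach.of_zero hU hpm hmn hf (by simp))
  by_cases hap : a = p
  · subst hap
    rw [Pi.add_apply, e_self, hya.apply_self hc] at hfp
    simp at hfp
  obtain ⟨W, rfl⟩ := Multiset.exists_cons_of_mem hfW
  by_cases hpy : Tail b c p y
  · exact hnr (Reach.rotate hU rfl hap hpy (e_sub_e_mem hmn))
  rcases hya.cases_of_not hpy with ⟨rfl, -⟩ | ⟨q, hq, haq, rfl⟩
  · rw [Pi.add_apply, e_self, e_ne (Ne.symm hap)] at hfp
    simp at hfp
  -- Now f = e_a - e_q with a < q ≤ p. If q = p, then `f` and e_p - e_n produce e_a - e_n, against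
  -- the minimality of `p`.
  rcases hq.eq_or_lt with rfl | hqp
  · refine hmin a haq (Reach.swap (a := e q + -e n) (b := e a + -e q) _ 0 ((e m + e q) ::ₘ W) hU
      ?_ (e_sub_e_mem (haq.trans hpn)) zero_mem_config (by abel))
    rw [Multiset.cons_swap (e m + e q)]
  -- Since q < n, the sum is nonnegative at `q`, so some e_q + y' compensates `f`. Either the two
  -- produce 0 + (e_a + y'), and `Reach.of_zero` applies, or y' = e_a and e_q + e_a serves as the
  -- third vector of a rotation.
  have hsq := hpos q (hqp.trans hpn)
  simp only [Multiset.sum_cons, Pi.add_apply, Pi.neg_apply, e_self, e_ne hqp.ne,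
    e_ne (hqp.trans hpn).ne, e_ne (hqp.trans hpm).ne, e_ne haq.ne'] at hsq
  obtain ⟨f', hf', hfq⟩ := exists_mem_pos q W (by omega)
  obtain ⟨y', hy', rfl⟩ := eq_of_apply_pos (hU f' (by simp [hf'])) hfq
  obtain ⟨W, rfl⟩ := Multiset.exists_cons_of_mem hf'
  by_cases hay : Tail b c a y'
  · refine hnr (Reach.via (a := e a + -e q) (b := e q + y') (e a + y') 0
      ((e p + -e n) ::ₘ (e m + e p) ::ₘ W) hU ?_ hay.mem zero_mem_config (by abel) fun hU' =>
        Reach.of_zero hU' hpm hmn (by simp) (by simp))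
    simp only [← Multiset.singleton_add]; abel
  · rcases hy'.cases_of_not hay with ⟨rfl, -⟩ | ⟨r, hr, hr', rfl⟩
    · refine hnr (Reach.rotate (W := (e a + -e q) ::ₘ W) (r := q) (y := e a) hU ?_ hqp.ne
        (.pos a (Or.inl hap)) (e_sub_e_mem hmn))
      rw [Multiset.cons_swap (e q + e a)]
    · exact absurd (haq.trans hr') (not_lt.2 hr)

theorem exists_reach_minimal {U : Multiset (Fin d → ℤ)} {n : Fin d}
    (hU : ∀ x ∈ U, x ∈ config b c d) (hn : U.sum n < 0) :
    ∃ p < n, 0 < U.sum p ∧ Reach (config b c d) U (e p + -e n) ∧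
      ∀ q < p, ¬ Reach (config b c d) U (e q + -e n) := by
  obtain ⟨x, hx, hxn⟩ := exists_mem_neg n U hn
  obtain ⟨p, hp, rfl⟩ := eq_of_apply_neg (hU x hx) hxn
  obtain ⟨p, ⟨hp, hr⟩, hmin⟩ := WellFounded.has_min (wellFounded_lt (α := Fin d))
    {p | p < n ∧ Reach (config b c d) U (e p + -e n)} ⟨p, hp, .of_mem hx⟩
  have hmin' : ∀ q < p, ¬ Reach (config b c d) U (e q + -e n) := fun q hq h =>
    hmin q ⟨hq.trans hp, h⟩ hq
  refine ⟨p, hp, ?_, hr, hmin'⟩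
  by_contra! h
  obtain ⟨q, hq, h⟩ := exists_lt_reach hU hp hr h
  exact hmin' q hq h

theorem reach_last_or_sum_eq_card {U : Multiset (Fin d → ℤ)} {m n : Fin d}
    (hU : ∀ x ∈ U, x ∈ config b c d) (hn : U.sum n < 0) (hpos : ∀ q < n, 0 ≤ U.sum q)
    (hmn : m < n) (hm : 0 < U.sum m) (hlast : ∀ q < n, 0 < U.sum q → q ≤ m) :
    Reach (config b c d) U (e m + -e n) ∨
      ∃ p, ¬ c ∧ U.sum p = U.card ∧ Reach (config b c d) U (e p + -e n) := by
  obtain ⟨p, hp, hp0, hr, hmin⟩ := exists_reach_minimal hU hn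
  rcases (hlast p hp hp0).eq_or_lt with rfl | hpm
  · exact Or.inl hr
  obtain ⟨W, hW⟩ := id hr
  have hs := hW.sum_eq
  rcases reach_or_forall_eq_one (hW.subset hU) hpm hmn (by simp) (by rwa [← hs])
    (by rwa [← hs]) (fun q hq h => hmin q hq (hW.reach h)) with h | ⟨hc, h⟩
  · exact Or.inl (hW.reach h)
  · refine Or.inr ⟨p, hc, ?_, hr⟩
    rw [hs, hW.card_eq]
    exact sum_apply_eq_card p _ h

/-- Every vector has coordinate 1 at `p`, so the one that is negative at `n` can only be e_p - e_n.
-/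
theorem reach_of_sum_eq_card {V : Multiset (Fin d → ℤ)} {p n : Fin d} (hc : ¬ c)
    (hV : ∀ x ∈ V, x ∈ config b c d) (hn : V.sum n < 0) (hp : V.sum p = V.card) :
    Reach (config b c d) V (e p + -e n) := by
  have h1 := forall_apply_eq_one p V (fun x hx => apply_le_one hc (hV x hx) p) hp
  obtain ⟨x, hx, hxn⟩ := exists_mem_neg n V hn
  obtain ⟨q, hq, rfl⟩ := eq_of_apply_neg (hV x hx) hxn
  have h := h1 _ hx
  by_cases hpq : p = q
  · subst hpq; exact .of_mem hx
  · have := e_nonneg n p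
    rw [Pi.add_apply, Pi.neg_apply, e_ne hpq] at h
    omega

theorem exists_common_of_neg {U V : Multiset (Fin d → ℤ)} (hU : ∀ x ∈ U, x ∈ config b c d)
    (hV : ∀ x ∈ V, x ∈ config b c d) (hcard : U.card = V.card) (hsum : U.sum = V.sum)
    (hneg : ∃ n, U.sum n < 0) :
    ∃ x, Reach (config b c d) U x ∧ Reach (config b c d) V x := by
  obtain ⟨n, hn, hmin⟩ := WellFounded.has_min (wellFounded_lt (α := Fin d))
    {n | U.sum n < 0} hneg
  have hpos : ∀ q < n, 0 ≤ U.sum q := fun q hq => not_lt.1 fun h => hmin q h hq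
  obtain ⟨p, hp, hp0, -, -⟩ := exists_reach_minimal hU hn
  obtain ⟨m, ⟨hmn, hm⟩, hmax⟩ := WellFounded.has_min (wellFounded_gt (α := Fin d))
    {m | m < n ∧ 0 < U.sum m} ⟨p, hp, hp0⟩
  have hlast : ∀ q < n, 0 < U.sum q → q ≤ m := fun q hq h => not_lt.1 (hmax q ⟨hq, h⟩)
  have hn' : U.sum n < 0 := hn
  rcases reach_last_or_sum_eq_card hU hn hpos hmn hm hlast with h | ⟨q, hc, hq, h⟩
  · rw [hsum] at hn' hpos hm hlast
    rcases reach_last_or_sum_eq_card hV hn' hpos hmn hm hlast with h' | ⟨q, hc, hq, h'⟩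
    · exact ⟨_, h, h'⟩
    · exact ⟨_, reach_of_sum_eq_card hc hU hn (by rw [hsum, hcard, hq]), h'⟩
  · exact ⟨_, h, reach_of_sum_eq_card hc hV (by rwa [← hsum]) (by rw [← hsum, ← hcard, hq])⟩

/-! ### Fibers without negative coordinates -/

/-- Some e_j + y compensates e_i - e_j, and (e_i - e_j) + (e_j + y) = 0 + (e_i + y) unless y = e_i
without 2e_i. In that case a third vector `f` whose coordinate at `i` is not 1 is used; `i` is
chosen minimal to control the position of `f`. -/
theorem reach_zero_or_forall_eq_one {U : Multiset (Fin d → ℤ)}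
    (hU : ∀ x ∈ U, x ∈ config b c d) (hpos : ∀ q, 0 ≤ U.sum q)
    (hex : ∃ i j, i < j ∧ e i + -e j ∈ U) :
    Reach (config b c d) U 0 ∨ ∃ i, ¬ c ∧ ∀ x ∈ U, x i = 1 := by
  obtain ⟨i, ⟨j, hij, hE⟩, hmin⟩ := WellFounded.has_min (wellFounded_lt (α := Fin d))
    {i | ∃ j, i < j ∧ e i + -e j ∈ U} hex
  obtain ⟨U, rfl⟩ := Multiset.exists_cons_of_mem hE
  have hsj := hpos j
  rw [Multiset.sum_cons, Pi.add_apply, Pi.add_apply, Pi.neg_apply, e_ne hij.ne', e_self] at hsj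
  obtain ⟨g, hg, hgj⟩ := exists_mem_pos j U (by omega)
  obtain ⟨y, hy, rfl⟩ := eq_of_apply_pos (hU g (by simp [hg])) hgj
  obtain ⟨W, rfl⟩ := Multiset.exists_cons_of_mem hg
  by_cases hiy : Tail b c i y
  · exact Or.inl (Reach.swap _ (e i + y) W hU rfl zero_mem_config hiy.mem (by abel))
  rcases hy.cases_of_not hiy with ⟨rfl, hc⟩ | ⟨q, hq, hq', rfl⟩
  swap
  · exact absurd (hij.trans hq') (not_lt.2 hq)
  by_contra! hcon
  obtain ⟨hnr, hcon⟩ := hcon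
  obtain ⟨f, hf, hfi⟩ := hcon i hc
  have hfW : f ∈ W := by
    simp only [Multiset.mem_cons] at hf
    rcases hf with rfl | rfl | hf
    · rw [Pi.add_apply, Pi.neg_apply, e_self, e_ne hij.ne] at hfi
      simp at hfi
    · rw [Pi.add_apply, e_self, e_ne hij.ne] at hfi
      simp at hfi
    · exact hf
  -- For i < a, the pair e_i - e_j, e_j + e_i becomes e_i - e_a, e_a + e_i, and then e_i - e_a
  -- cancels against `f`.
  have key : ∀ a y, i < a → f = e a + y → ¬ Tail b c i y := by
    rintro a y hia rfl hiy
    obtain ⟨W, rfl⟩ := Multiset.exists_cons_of_mem hfW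
    refine hnr (Reach.via (e i + -e a) (e a + e i) ((e a + y) ::ₘ W) hU rfl (e_sub_e_mem hia)
      (e_add_e_mem hia.ne') (by abel) fun hU' => ?_)
    refine Reach.swap (a := e i + -e a) (b := e a + y) _ (e i + y) ((e a + e i) ::ₘ W) hU' ?_
      zero_mem_config hiy.mem (by abel)
    rw [Multiset.cons_swap (e a + e i)]
  rcases config_cases (hU f hf) with rfl | ⟨a, y, hya, rfl⟩
  · exact hnr (.of_mem hf)
  by_cases hai : a = i
  · subst hai
    rw [Pi.add_apply, e_self, hya.apply_self hc] at hfi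
    simp at hfi
  cases hya with
  | neg q haq =>
    have hia : i < a := lt_of_le_of_ne (not_lt.1 (hmin a ⟨q, haq, hf⟩)) (Ne.symm hai)
    exact key a _ hia rfl (.neg q (hia.trans haq))
  | zero hb =>
    obtain ⟨W, rfl⟩ := Multiset.exists_cons_of_mem hfW
    refine hnr (Reach.via (e i) (e i) ((e a + 0) ::ₘ W) hU rfl (e_mem hb i) (e_mem hb i)
      (by abel) fun hU' => ?_)
    refine Reach.swap (a := e i) (b := e a + 0) _ (e a + e i) (e i ::ₘ W) hU' ?_
      zero_mem_config (e_add_e_mem hai) (by abel)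
    rw [Multiset.cons_swap (e a + 0)]
  | pos q hqa =>
    replace hqa := hqa.resolve_right hc
    by_cases hqi : q = i
    · subst hqi
      rw [Pi.add_apply, e_self, e_ne (Ne.symm hai)] at hfi
      simp at hfi
    rcases lt_or_gt_of_ne hai with hai' | hai'
    swap
    · exact key a _ hai' rfl (.pos q (Or.inl hqi))
    rcases lt_or_gt_of_ne hqi with hqi' | hqi'
    swap
    · exact key q (e a) hqi' (add_comm _ _) (.pos a (Or.inl hai))
    obtain ⟨W, rfl⟩ := Multiset.exists_cons_of_mem hfW
    -- Both indices of `f` lie below `i`, so e_q - e_j is available; it then cancels against e_j +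
    -- e_i, leaving 0 and e_q + e_i.
    refine hnr (Reach.via (a := e i + -e j) (b := e a + e q) (e a + e i) (e q + -e j)
      ((e j + e i) ::ₘ W) hU ?_ (e_add_e_mem hai) (e_sub_e_mem (hqi'.trans hij))
      (by abel) fun hU' => ?_)
    · rw [Multiset.cons_swap (e j + e i)]
    · refine Reach.swap (a := e q + -e j) (b := e j + e i) _ (e q + e i) ((e a + e i) ::ₘ W) hU' ?_
        zero_mem_config (e_add_e_mem hqi) (by abel)
      simp only [← Multiset.singleton_add]; abel

theorem exists_eq_e_of_coordSum_lt {x : Fin d → ℤ} (hx : x ∈ config b c d) (h0 : x ≠ 0)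
    (hpos : ∀ q, 0 ≤ x q) (hs : coordSum d x < 2) : b ∧ ∃ a, x = e a := by
  rcases config_cases hx with rfl | ⟨a, y, hy, rfl⟩
  · exact absurd rfl h0
  cases hy with
  | zero hb => exact ⟨hb, a, by simp⟩
  | pos q => simp at hs
  | neg q hq =>
    have := hpos q
    rw [Pi.add_apply, Pi.neg_apply, e_self, e_ne hq.ne'] at this
    omega

theorem reach_zero_or_forall_eq_one_or_le_coordSum {U : Multiset (Fin d → ℤ)}
    (hU : ∀ x ∈ U, x ∈ config b c d) (hpos : ∀ x ∈ U, ∀ q, 0 ≤ x q) :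
    Reach (config b c d) U 0 ∨ (∃ i, ¬ c ∧ ∀ x ∈ U, x i = 1) ∨
      2 * (U.card : ℤ) - 1 ≤ coordSum d U.sum := by
  by_contra! hcon
  obtain ⟨hnr, hcon, hs⟩ := hcon
  have h0 : ∀ x ∈ U, x ≠ 0 := by
    rintro x hx rfl
    exact hnr (.of_mem hx)
  -- The total misses 2N by at least two and each e_a accounts for one, so two such vectors exist.
  -- They merge into 0 and their sum unless they are equal and 2e_a is missing.
  obtain ⟨x, hx, hx2⟩ := exists_mem_lt_of_sum_lt (coordSum d) 2 U (by omega)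
  obtain ⟨hb, a, rfl⟩ := exists_eq_e_of_coordSum_lt (hU x hx) (h0 x hx) (hpos x hx) hx2
  obtain ⟨U, rfl⟩ := Multiset.exists_cons_of_mem hx
  rw [Multiset.sum_cons, map_add, coordSum_e, Multiset.card_cons] at hs
  push_cast at hs
  obtain ⟨x, hx', hx2⟩ := exists_mem_lt_of_sum_lt (coordSum d) 2 U (by linarith)
  have hx0 := Multiset.mem_cons_of_mem (b := e a) hx'
  obtain ⟨-, a', rfl⟩ := exists_eq_e_of_coordSum_lt (hU x hx0) (h0 x hx0) (hpos x hx0) hx2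
  obtain ⟨W, rfl⟩ := Multiset.exists_cons_of_mem hx'
  have hadd : ∀ r s W', e a ::ₘ e a' ::ₘ W = e r ::ₘ e s ::ₘ W' → ¬ Tail b c r (e s) :=
    fun r s W' h ht =>
      hnr (Reach.swap _ (e r + e s) W' hU h zero_mem_config ht.mem (by abel))
  by_cases haa : a' = a
  swap
  · exact hadd a a' W rfl (.pos a' (Or.inl haa))
  subst haa
  have hc : ¬ c := fun hc => hadd a' a' W rfl (.pos a' (Or.inr hc))
  obtain ⟨f, hf, hfa⟩ := hcon a' hc
  have hfW : f ∈ W := by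
    simp only [Multiset.mem_cons] at hf
    rcases hf with rfl | rfl | hf
    · exact absurd (e_self _) hfa
    · exact absurd (e_self _) hfa
    · exact hf
  rcases config_cases (hU f hf) with rfl | ⟨r, y, hy, rfl⟩
  · exact h0 _ hf rfl
  by_cases hra : r = a'
  · subst hra
    rw [Pi.add_apply, e_self, hy.apply_self hc] at hfa
    simp at hfa
  obtain ⟨W, rfl⟩ := Multiset.exists_cons_of_mem hfW
  cases hy with
  | zero =>
    refine hadd a' r (e a' ::ₘ W) ?_ (.pos r (Or.inl hra))
    rw [add_zero, Multiset.cons_swap (e r)]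
  | neg q hq =>
    have := hpos _ hf q
    rw [Pi.add_apply, Pi.neg_apply, e_self, e_ne hq.ne'] at this
    omega
  | pos q hq =>
    by_cases hqa : q = a'
    · subst hqa
      rw [Pi.add_apply, e_self, e_ne (Ne.symm hra)] at hfa
      simp at hfa
    refine hnr (Reach.via (a := e a') (b := e r + e q) (e q) (e r + e a') (e a' ::ₘ W) hU ?_
      (e_mem hb q) (e_add_e_mem hra) (by abel) fun hU' => ?_)
    · rw [Multiset.cons_swap (e r + e q)]
    · refine Reach.swap (a := e q) (b := e a') _ (e q + e a') ((e r + e a') ::ₘ W) hU' ?_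
        zero_mem_config (e_add_e_mem hqa) (by abel)
      rw [Multiset.cons_swap (e r + e a')]

end Connectivity

end RootToric

namespace RootToric

/-! ### Fibers in which one coordinate is constantly 1 -/

section Connectivity

variable {d : ℕ} {b c : Prop}

/-- The sum is a multiple of e_i, so unless e_i itself occurs, some e_i + e_q is balanced by e_i -
e_q. This pair can be traded for two copies of e_i, or for e_i - e_j and e_i + e_j with any j > i.
-/
theorem reach_of_forall_eq_one {U : Multiset (Fin d → ℤ)} {i : Fin d} (hc : ¬ c)
    (hU : ∀ x ∈ U, x ∈ config b c d) (hne : U ≠ 0) (hi : ∀ x ∈ U, x i = 1)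
    (hz : ∀ q ≠ i, U.sum q = 0) :
    (b ∧ Reach (config b c d) U (e i)) ∨
      (¬ b ∧ (∃ j, i < j) ∧ ∀ j, i < j → Reach (config b c d) U (e i + -e j)) := by
  have key : ∀ q W, q ≠ i → U = (e i + e q) ::ₘ (e i + -e q) ::ₘ W →
      (b ∧ Reach (config b c d) U (e i)) ∨
      (¬ b ∧ (∃ j, i < j) ∧ ∀ j, i < j → Reach (config b c d) U (e i + -e j)) := by
    intro q W hqi h
    by_cases hb : b
    · exact Or.inl ⟨hb, Reach.swap _ (e i) W hU h (e_mem hb i) (e_mem hb i) (by abel)⟩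
    · refine Or.inr ⟨hb, ⟨q, ?_⟩, fun j hj => ?_⟩
      · obtain ⟨p, hp, h⟩ := eq_of_apply_neg (hU (e i + -e q) (by simp [h])) (n := q)
          (by rw [Pi.add_apply, Pi.neg_apply, e_self, e_ne hqi]; norm_num)
        have : e i = e p := by simpa using h
        have : i = p := by
          by_contra hip
          have h := congrFun this i
          rw [e_self, e_ne hip] at h
          omega
        rwa [this]
      · exact Reach.swap _ (e i + e j) W hU h (e_sub_e_mem hj) (e_add_e_mem hj.ne) (by abel)
  obtain ⟨x, hx⟩ := Multiset.exists_mem_of_ne_zero hne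
  obtain ⟨y, hy, rfl⟩ := eq_of_apply_pos (hU x hx) (p := i) (by rw [hi x hx]; norm_num)
  obtain ⟨W, rfl⟩ := Multiset.exists_cons_of_mem hx
  cases hy with
  | zero hb => exact Or.inl ⟨hb, .of_mem (by simp)⟩
  | pos q hq =>
    have hqi := hq.resolve_right hc
    have hs := hz q hqi
    rw [Multiset.sum_cons, Pi.add_apply, Pi.add_apply, e_self, e_ne hqi] at hs
    obtain ⟨x, hx, hxq⟩ := exists_mem_neg q W (by omega)
    obtain ⟨p, hp, rfl⟩ := eq_of_apply_neg (hU x (by simp [hx])) hxq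
    have h1 := hi (e p + -e q) (by simp [hx])
    rw [Pi.add_apply, Pi.neg_apply, e_ne hqi.symm] at h1
    have hpi : i = p := by
      by_contra hip
      rw [e_ne hip] at h1
      omega
    subst hpi
    obtain ⟨W, rfl⟩ := Multiset.exists_cons_of_mem hx
    exact key q W hqi rfl
  | neg q hq =>
    have hs := hz q hq.ne'
    rw [Multiset.sum_cons, Pi.add_apply, Pi.add_apply, Pi.neg_apply, e_self, e_ne hq.ne'] at hs
    obtain ⟨x, hx, hxq⟩ := exists_mem_pos q W (by omega)
    obtain rfl := eq_of_apply_pos_pos (hU x (by simp [hx])) hq.ne'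
      (by rw [hi x (by simp [hx])]; norm_num) hxq
    obtain ⟨W, rfl⟩ := Multiset.exists_cons_of_mem hx
    exact key q W hq.ne' (Multiset.cons_swap _ _ _)

/-- If the sum is positive at some q ≠ i, then e_i + e_q already lies in both multisets, being the
only vector positive at `i` and `q`. -/
theorem exists_common_of_forall_eq_one {U V : Multiset (Fin d → ℤ)} {i : Fin d} (hc : ¬ c)
    (hU : ∀ x ∈ U, x ∈ config b c d) (hV : ∀ x ∈ V, x ∈ config b c d)
    (hcard : U.card = V.card) (hsum : U.sum = V.sum) (hne : U ≠ 0)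
    (hpos : ∀ q, 0 ≤ U.sum q) (hi : ∀ x ∈ U, x i = 1) :
    ∃ x, Reach (config b c d) U x ∧ Reach (config b c d) V x := by
  have hiV : ∀ x ∈ V, x i = 1 := forall_apply_eq_one i V
    (fun x hx => apply_le_one hc (hV x hx) i) (by
      rw [← hsum, ← hcard]; exact sum_apply_eq_card i U hi)
  have hneV : V ≠ 0 := fun h => hne (by rwa [← Multiset.card_eq_zero, hcard, Multiset.card_eq_zero])
  by_cases hq : ∃ q ≠ i, 0 < U.sum q
  · obtain ⟨q, hqi, hq⟩ := hq
    have key : ∀ V : Multiset (Fin d → ℤ), (∀ x ∈ V, x ∈ config b c d) → (∀ x ∈ V, x i = 1) →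
        0 < V.sum q → Reach (config b c d) V (e i + e q) := by
      intro V hV hi hq
      obtain ⟨x, hx, hxq⟩ := exists_mem_pos q V hq
      rw [← eq_of_apply_pos_pos (hV x hx) hqi (by rw [hi x hx]; norm_num) hxq]
      exact .of_mem hx
    exact ⟨_, key U hU hi hq, key V hV hiV (by rwa [← hsum])⟩
  · push Not at hq
    have hz : ∀ q ≠ i, U.sum q = 0 := fun q h => le_antisymm (hq q h) (hpos q)
    rcases reach_of_forall_eq_one hc hU hne hi hz with ⟨hb, h⟩ | ⟨hb, ⟨j, hj⟩, h⟩ <;>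
    rcases reach_of_forall_eq_one hc hV hneV hiV (by rwa [← hsum]) with ⟨hb', h'⟩ | ⟨hb', -, h'⟩
    · exact ⟨_, h, h'⟩
    · exact absurd hb hb'
    · exact absurd hb' hb
    · exact ⟨_, h j hj, h' j hj⟩

/-! ### Fibers of nearly maximal coordinate sum -/

theorem eq_of_one_le_coordSum {x : Fin d → ℤ} (hx : x ∈ config b c d) (h : 1 ≤ coordSum d x) :
    (b ∧ ∃ a, x = e a) ∨ ∃ a q, (q ≠ a ∨ c) ∧ x = e a + e q := by
  rcases config_cases hx with rfl | ⟨a, y, hy, rfl⟩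
  · simp at h
  cases hy with
  | zero hb => exact Or.inl ⟨hb, a, by simp⟩
  | pos q hq => exact Or.inr ⟨a, q, hq, rfl⟩
  | neg q => simp at h

theorem apply_nonneg_of_one_le_coordSum {x : Fin d → ℤ} (hx : x ∈ config b c d)
    (h : 1 ≤ coordSum d x) (p : Fin d) : 0 ≤ x p := by
  rcases eq_of_one_le_coordSum hx h with ⟨-, a, rfl⟩ | ⟨a, q, -, rfl⟩
  · exact e_nonneg a p
  · exact add_nonneg (e_nonneg a p) (e_nonneg q p)

theorem apply_le_sum_of_mem {U : Multiset (Fin d → ℤ)} (hU : ∀ x ∈ U, x ∈ config b c d)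
    (h1 : ∀ x ∈ U, 1 ≤ coordSum d x) {p : Fin d} {x : Fin d → ℤ} (hx : x ∈ U) :
    x p ≤ U.sum p := by
  obtain ⟨W, rfl⟩ := Multiset.exists_cons_of_mem hx
  by_contra! h
  rw [Multiset.sum_cons, Pi.add_apply] at h
  obtain ⟨x, hx, h⟩ := exists_mem_neg p W (by omega)
  exact absurd (apply_nonneg_of_one_le_coordSum (hU x (by simp [hx])) (h1 x (by simp [hx])) p)
    (not_le.2 h)

theorem one_le_coordSum_of_mem {U : Multiset (Fin d → ℤ)} (hU : ∀ x ∈ U, x ∈ config b c d)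
    (hs : 2 * (U.card : ℤ) - 1 ≤ coordSum d U.sum) : ∀ x ∈ U, 1 ≤ coordSum d x := by
  intro x hx
  obtain ⟨W, rfl⟩ := Multiset.exists_cons_of_mem hx
  have := sum_le_of_forall_le (coordSum d) 2 W fun x hx => coordSum_le_two (hU x (by simp [hx]))
  rw [Multiset.sum_cons, map_add, Multiset.card_cons] at hs
  push_cast at hs
  linarith

/-- The basic exchange, with a rotation when it is blocked. `hzp` puts the vector positive at `p`
outside e_a + z; `hz` ensures that e_a + z has coordinate exactly 1 at `a` when 2e_a is missing. -/
theorem reach_or_sum_eq_card {V : Multiset (Fin d → ℤ)} {a p : Fin d} {z : Fin d → ℤ}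
    (hV : ∀ x ∈ V, x ∈ config b c d) (h1 : ∀ x ∈ V, 1 ≤ coordSum d x)
    (hE : e a + z ∈ V) (hap : a ≠ p) (hp : 0 < V.sum p) (hzp : (e a + z) p ≤ 0)
    (hz : 0 ≤ z a) (hpz : e p + z ∈ config b c d) :
    Reach (config b c d) V (e p + z) ∨ (¬ c ∧ V.sum a = V.card) := by
  obtain ⟨V, rfl⟩ := Multiset.exists_cons_of_mem hE
  rw [Multiset.sum_cons, Pi.add_apply] at hp
  obtain ⟨g, hg, hgp⟩ := exists_mem_pos p V (by omega)
  obtain ⟨y, hy, rfl⟩ := eq_of_apply_pos (hV g (by simp [hg])) hgp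
  have hneg : ∀ r q, e r + -e q ∉ (e a + z) ::ₘ V := fun r q h => by
    have := h1 _ h
    simp at this
  obtain ⟨W, rfl⟩ := Multiset.exists_cons_of_mem hg
  by_cases hay : Tail b c a y
  · exact Or.inl (Reach.swap _ (e a + y) W hV rfl hpz hay.mem (by abel))
  rcases hy.cases_of_not hay with ⟨rfl, hc⟩ | ⟨q, -, -, rfl⟩
  swap
  · exact absurd (by simp) (hneg p q)
  by_contra! hcon
  obtain ⟨hnr, hcon⟩ := hcon
  refine hcon hc (sum_apply_eq_card a _ fun f hf => ?_)
  by_contra hfa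
  have hfW : f ∈ W := by
    simp only [Multiset.mem_cons] at hf
    rcases hf with rfl | rfl | hf
    · have := apply_le_one hc (hV (e a + z) (by simp)) a
      rw [Pi.add_apply, e_self] at this hfa
      omega
    · rw [Pi.add_apply, e_self, e_ne hap] at hfa
      simp at hfa
    · exact hf
  obtain ⟨W, rfl⟩ := Multiset.exists_cons_of_mem hfW
  rcases eq_of_one_le_coordSum (hV f hf) (h1 f hf) with ⟨hb, r, rfl⟩ | ⟨r, q, hq, rfl⟩
  · have hra : r ≠ a := by
      rintro rfl
      exact hfa (e_self _)
    exact hnr (Reach.rotate (W := W) (r := r) (y := 0) hV (by rw [add_zero]) hra (.zero hb) hpz)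
  · have hqr := hq.resolve_right hc
    have hra : r ≠ a := by
      rintro rfl
      rw [Pi.add_apply, e_self, e_ne hqr.symm] at hfa
      simp at hfa
    have hqa : q ≠ a := by
      rintro rfl
      rw [Pi.add_apply, e_self, e_ne hqr] at hfa
      simp at hfa
    exact hnr (Reach.rotate hV rfl hra (.pos q (Or.inl hqa)) hpz)

/-- In `V`, e_j is exchanged for e_i. In the exceptional case every vector of `U` would have
coordinate 1 at `j`, which e_i does not. -/
theorem exists_common_of_e_mem {U V : Multiset (Fin d → ℤ)}
    (hU : ∀ x ∈ U, x ∈ config b c d) (hV : ∀ x ∈ V, x ∈ config b c d)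
    (hcard : U.card = V.card) (hsum : U.sum = V.sum)
    (hU1 : ∀ x ∈ U, 1 ≤ coordSum d x) (hV1 : ∀ x ∈ V, 1 ≤ coordSum d x) (hb : b)
    {i j : Fin d} (hi : e i ∈ U) (hj : e j ∈ V) :
    ∃ x, Reach (config b c d) U x ∧ Reach (config b c d) V x := by
  by_cases hij : j = i
  · subst hij; exact ⟨_, .of_mem hi, .of_mem hj⟩
  refine ⟨e i, .of_mem hi, ?_⟩
  have hp := apply_le_sum_of_mem (p := i) hU hU1 hi
  rw [e_self, hsum] at hp
  rcases reach_or_sum_eq_card (a := j) (p := i) (z := 0) hV hV1 (by simpa using hj) hij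
    (by omega) (by rw [add_zero, e_ne (Ne.symm hij)]) le_rfl (by simpa using e_mem hb i)
    with h | ⟨hc, h⟩
  · simpa using h
  · have := forall_apply_eq_one j U (fun x hx => apply_le_one hc (hU x hx) j)
      (by rw [hsum, h, hcard]) _ hi
    rw [e_ne hij] at this
    omega

theorem exists_common_of_coordSum_eq {U V : Multiset (Fin d → ℤ)}
    (hU : ∀ x ∈ U, x ∈ config b c d) (hV : ∀ x ∈ V, x ∈ config b c d)
    (hcard : U.card = V.card) (hsum : U.sum = V.sum) (hne : U ≠ 0)
    (hU2 : ∀ x ∈ U, coordSum d x = 2) (hV2 : ∀ x ∈ V, coordSum d x = 2) :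
    ∃ x, Reach (config b c d) U x ∧ Reach (config b c d) V x := by
  have hU1 : ∀ x ∈ U, 1 ≤ coordSum d x := fun x hx => by rw [hU2 x hx]; norm_num
  have hV1 : ∀ x ∈ V, 1 ≤ coordSum d x := fun x hx => by rw [hV2 x hx]; norm_num
  have hform : ∀ q, ∀ x ∈ V, 0 < x q → ∃ a, (a ≠ q ∨ c) ∧ x = e a + e q := by
    intro q x hx hq
    obtain ⟨y, hy, rfl⟩ := eq_of_apply_pos (hV x hx) hq
    have h2 := hV2 _ hx
    cases hy with
    | zero => simp at h2
    | pos r hr => exact ⟨r, hr, add_comm _ _⟩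
    | neg => simp at h2
  obtain ⟨x, hx⟩ := Multiset.exists_mem_of_ne_zero hne
  rcases eq_of_one_le_coordSum (hU x hx) (hU1 x hx) with ⟨-, a, rfl⟩ | ⟨p, q, hpq, rfl⟩
  · have := hU2 _ hx
    simp at this
  refine ⟨_, .of_mem hx, ?_⟩
  have hq := apply_le_sum_of_mem (p := q) hU hU1 hx
  have hp := apply_le_sum_of_mem (p := p) hU hU1 hx
  have hp' := e_nonneg q p
  have hq' := e_nonneg p q
  rw [Pi.add_apply, e_self, hsum] at hp hq
  obtain ⟨g, hg, hgq⟩ := exists_mem_pos q V (by omega)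
  obtain ⟨a, ha, rfl⟩ := hform q g hg hgq
  by_cases hap : a = p
  · subst hap; exact .of_mem hg
  -- If q = p, the sum is at least 2 at `p`, while e_a + e_q contributes only 1; a second vector e_r
  -- + e_q of `V` then yields 2e_q and e_a + e_r.
  by_cases hqp : q = p
  · subst hqp
    have hc : c := hpq.resolve_left (by simp)
    obtain ⟨W, rfl⟩ := Multiset.exists_cons_of_mem hg
    rw [Multiset.sum_cons, Pi.add_apply, Pi.add_apply, e_self, e_ne (Ne.symm hap)] at hp
    obtain ⟨g, hg', hgq⟩ := exists_mem_pos q W (by omega)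
    obtain ⟨r, -, rfl⟩ := hform q g (by simp [hg']) hgq
    obtain ⟨W, rfl⟩ := Multiset.exists_cons_of_mem hg'
    exact Reach.swap _ (e a + e r) W hV rfl (hU _ hx) (Tail.pos r (Or.inr hc)).mem (by abel)
  · rcases reach_or_sum_eq_card hV hV1 hg hap (by omega)
      (by rw [Pi.add_apply, e_ne (Ne.symm hap), e_ne (Ne.symm hqp)]; rfl) (e_nonneg q a) (hU _ hx)
      with h | ⟨hc, h⟩
    · exact h
    · have h3 := forall_apply_eq_one a U (fun x hx => apply_le_one hc (hU x hx) a)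
        (by rw [hsum, h, hcard]) _ hx
      have haq := ha.resolve_right hc
      rw [Pi.add_apply, e_ne hap, e_ne haq] at h3
      omega

theorem exists_common_of_le_coordSum {U V : Multiset (Fin d → ℤ)}
    (hU : ∀ x ∈ U, x ∈ config b c d) (hV : ∀ x ∈ V, x ∈ config b c d)
    (hcard : U.card = V.card) (hsum : U.sum = V.sum) (hne : U ≠ 0)
    (hs : 2 * (U.card : ℤ) - 1 ≤ coordSum d U.sum) :
    ∃ x, Reach (config b c d) U x ∧ Reach (config b c d) V x := by
  have hU1 := one_le_coordSum_of_mem hU hs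
  have hV1 := one_le_coordSum_of_mem hV (by rwa [← hcard, ← hsum])
  -- Either every vector has coordinate sum 2, or, since the total misses 2N, each multiset contains
  -- some e_i.
  by_cases h2 : coordSum d U.sum = 2 * U.card
  · exact exists_common_of_coordSum_eq hU hV hcard hsum hne
      (forall_eq_of_sum_eq _ 2 U (fun x hx => coordSum_le_two (hU x hx)) h2)
      (forall_eq_of_sum_eq _ 2 V (fun x hx => coordSum_le_two (hV x hx))
        (by rw [← hsum, h2, hcard]))
  · have key : ∀ U : Multiset (Fin d → ℤ), (∀ x ∈ U, x ∈ config b c d) →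
        (∀ x ∈ U, 1 ≤ coordSum d x) → coordSum d U.sum ≠ 2 * U.card → b ∧ ∃ i, e i ∈ U := by
      intro U hU hU1 h2
      have hle := sum_le_of_forall_le (coordSum d) 2 U fun x hx => coordSum_le_two (hU x hx)
      obtain ⟨x, hx, hx2⟩ := exists_mem_lt_of_sum_lt (coordSum d) 2 U (lt_of_le_of_ne hle h2)
      rcases eq_of_one_le_coordSum (hU x hx) (hU1 x hx) with ⟨hb, a, rfl⟩ | ⟨p, q, -, rfl⟩
      · exact ⟨hb, a, hx⟩
      · simp at hx2
    obtain ⟨hb, i, hi⟩ := key U hU hU1 h2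
    obtain ⟨-, j, hj⟩ := key V hV hV1 (by rwa [← hsum, ← hcard])
    exact exists_common_of_e_mem hU hV hcard hsum hU1 hV1 hb hi hj

/-! ### Connectivity of all fibers -/

theorem reach_zero_or_forall_eq_one_or_le_coordSum_of_sum_nonneg {U : Multiset (Fin d → ℤ)}
    (hU : ∀ x ∈ U, x ∈ config b c d) (hpos : ∀ q, 0 ≤ U.sum q) :
    Reach (config b c d) U 0 ∨ (∃ i, ¬ c ∧ ∀ x ∈ U, x i = 1) ∨
      2 * (U.card : ℤ) - 1 ≤ coordSum d U.sum := by
  by_cases hex : ∃ i j, i < j ∧ e i + -e j ∈ U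
  · exact (reach_zero_or_forall_eq_one hU hpos hex).imp_right Or.inl
  · refine reach_zero_or_forall_eq_one_or_le_coordSum hU fun x hx q => not_lt.1 fun h => ?_
    obtain ⟨p, hp, rfl⟩ := eq_of_apply_neg (hU x hx) h
    exact hex ⟨p, q, hp, hx⟩

/-- Of the three outcomes for a nonnegative sum, the last two depend only on sum and cardinality.
Hence if either multiset falls under one of them, both do; otherwise both reach 0. -/
theorem exists_common {U V : Multiset (Fin d → ℤ)}
    (hU : ∀ x ∈ U, x ∈ config b c d) (hV : ∀ x ∈ V, x ∈ config b c d)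
    (hcard : U.card = V.card) (hsum : U.sum = V.sum) (hne : U ≠ 0) :
    ∃ x, Reach (config b c d) U x ∧ Reach (config b c d) V x := by
  by_cases hneg : ∃ n, U.sum n < 0
  · exact exists_common_of_neg hU hV hcard hsum hneg
  push Not at hneg
  have hneV : V ≠ 0 := fun h => hne (by rwa [← Multiset.card_eq_zero, hcard, Multiset.card_eq_zero])
  rcases reach_zero_or_forall_eq_one_or_le_coordSum_of_sum_nonneg hU hneg with h | ⟨i, hc, h⟩ | h
  · rcases reach_zero_or_forall_eq_one_or_le_coordSum_of_sum_nonneg hV (by rwa [← hsum]) with h' | ⟨i, hc, h'⟩ | h'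
    · exact ⟨_, h, h'⟩
    · obtain ⟨x, hx, hx'⟩ := exists_common_of_forall_eq_one hc hV hU hcard.symm hsum.symm hneV
        (by rwa [← hsum]) h'
      exact ⟨x, hx', hx⟩
    · exact exists_common_of_le_coordSum hU hV hcard hsum hne (by rwa [hsum, hcard])
  · exact exists_common_of_forall_eq_one hc hU hV hcard hsum hne hneg h
  · exact exists_common_of_le_coordSum hU hV hcard hsum hne h

/-- Multisets in the configuration with the same cardinality and the same sum are connected by
quadratic moves. -/
theorem conn_config {U V : Multiset (Fin d → ℤ)}
    (hU : ∀ x ∈ U, x ∈ config b c d) (hV : ∀ x ∈ V, x ∈ config b c d)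
    (hcard : U.card = V.card) (hsum : U.sum = V.sum) : Conn (config b c d) U V := by
  induction hn : U.card generalizing U V with
  | zero =>
    rw [hn] at hcard
    rw [Multiset.card_eq_zero.1 hn, Multiset.card_eq_zero.1 hcard.symm]
    exact .refl _
  | succ n ih =>
    obtain ⟨x, ⟨U', hU'⟩, V', hV'⟩ := exists_common hU hV hcard hsum
      (fun h => by simp [h] at hn)
    have h1 := hU'.card_eq
    have h2 := hV'.card_eq
    have h3 := hU'.sum_eq
    have h4 := hV'.sum_eq
    rw [Multiset.card_cons] at h1 h2
    rw [Multiset.sum_cons] at h3 h4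
    have h := ih (U := U') (V := V') (fun y hy => hU'.subset hU y (by simp [hy]))
      (fun y hy => hV'.subset hV y (by simp [hy])) (by omega)
      (add_left_cancel (a := x) (by rw [← h3, ← h4, hsum])) (by omega)
    exact hU'.trans ((h.cons x).trans hV'.symm)

/-- Connectivity passes to the subset of a configuration on which an additive functional is
minimal. -/
theorem Conn.restrict {M : Type*} [AddCommGroup M] {Φ Ψ : Set M} {U V : Multiset M}
    (h : Conn Φ U V) (f : M →+ ℤ) (h0 : ∀ x ∈ Φ, 0 ≤ f x) (hΨ : ∀ x ∈ Φ, f x = 0 → x ∈ Ψ)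
    (hU : ∀ x ∈ U, x ∈ Ψ) (hf : ∀ x ∈ Ψ, f x = 0) :
    Conn Ψ U V ∧ ∀ x ∈ V, x ∈ Ψ := by
  induction h with
  | refl U => exact ⟨.refl U, hU⟩
  | @step a b c d W ha hb hc hd hs =>
    have ha' := hU a (by simp)
    have hb' := hU b (by simp)
    have h := congrArg f hs
    rw [map_add, map_add, hf a ha', hf b hb'] at h
    have hc0 := h0 c hc
    have hd0 := h0 d hd
    have hc' := hΨ c hc (by omega)
    have hd' := hΨ d hd (by omega)
    refine ⟨.step W ha' hb' hc' hd' hs, fun x hx => ?_⟩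
    simp only [Multiset.mem_cons] at hx hU
    rcases hx with rfl | rfl | hx
    · exact hc'
    · exact hd'
    · exact hU x (Or.inr (Or.inr hx))
  | trans _ _ h1 h2 =>
    obtain ⟨h1, hV⟩ := h1 hU
    obtain ⟨h2, hW⟩ := h2 hV
    exact ⟨h1.trans h2, hW⟩

/-! ### The four root configurations -/

theorem posD_eq_config : posD d = config False False d := by
  simp [config]

theorem posB_eq_config : posB d = config True False d := by
  ext x
  simp only [config, posB, posD, Set.mem_union, Set.mem_ofPred_eq, true_and, false_and, or_false]
  exact or_right_comm

theorem posC_eq_config : posC d = config False True d := by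
  ext x
  simp only [config, posC, posD, Set.mem_union, Set.mem_ofPred_eq, le_iff_lt_or_eq]
  constructor
  · rintro (h | ⟨i, j, h | rfl, rfl⟩)
    · exact Or.inl (Or.inl (Or.inl h))
    · exact Or.inl (Or.inl (Or.inr ⟨i, j, h, rfl⟩))
    · exact Or.inr ⟨trivial, i, rfl⟩
  · rintro (((h | ⟨i, j, h, rfl⟩) | ⟨h, -⟩) | ⟨-, i, rfl⟩)
    · exact Or.inl h
    · exact Or.inr ⟨i, j, Or.inl h, rfl⟩
    · exact h.elim
    · exact Or.inr ⟨i, i, Or.inr rfl, rfl⟩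

theorem posA_subset_posD : posA d ⊆ posD d := Set.subset_union_left

theorem coordSum_of_mem_posA {x : Fin d → ℤ} (hx : x ∈ posA d) : coordSum d x = 0 := by
  rcases hx with rfl | ⟨i, j, -, rfl⟩ <;> simp

/-- The positive roots of the classical types, with the origin, satisfy connectivity. -/
theorem conn_of_eq_pos {Φ : Set (Fin d → ℤ)}
    (hΦ : Φ = posA d ∨ Φ = posB d ∨ Φ = posC d ∨ Φ = posD d) {U V : Multiset (Fin d → ℤ)}
    (hU : ∀ x ∈ U, x ∈ Φ) (hV : ∀ x ∈ V, x ∈ Φ)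
    (hcard : U.card = V.card) (hsum : U.sum = V.sum) : Conn Φ U V := by
  rcases hΦ with rfl | rfl | rfl | rfl
  · have h : Conn (posD d) U V := by
      rw [posD_eq_config]
      refine conn_config ?_ ?_ hcard hsum <;> rw [← posD_eq_config]
      · exact fun x hx => posA_subset_posD (hU x hx)
      · exact fun x hx => posA_subset_posD (hV x hx)
    refine (h.restrict (coordSum d) ?_ ?_ hU fun x => coordSum_of_mem_posA).1
    · rintro x (hx | ⟨i, j, -, rfl⟩)
      · rw [coordSum_of_mem_posA hx]
      · simp
    · rintro x (hx | ⟨i, j, -, rfl⟩) h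
      · exact hx
      · simp at h
  · rw [posB_eq_config] at *; exact conn_config hU hV hcard hsum
  · rw [posC_eq_config] at *; exact conn_config hU hV hcard hsum
  · rw [posD_eq_config] at *; exact conn_config hU hV hcard hsum

end Connectivity

end RootToric

namespace RootToric

/-! ### Quadratic relations among the vectors of a configuration -/

section Relations

variable {d : ℕ} {b c : Prop}

theorem neg_one_le_apply {x : Fin d → ℤ} (hx : x ∈ config b c d) (p : Fin d) : -1 ≤ x p := by
  by_contra! h
  obtain ⟨q, hq, rfl⟩ := eq_of_apply_neg hx (n := p) (by omega)
  rw [Pi.add_apply, Pi.neg_apply, e_self, e_ne hq.ne'] at h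
  omega

theorem coordSum_nonneg {x : Fin d → ℤ} (hx : x ∈ config b c d) : 0 ≤ coordSum d x := by
  rcases config_cases hx with rfl | ⟨a, y, hy, rfl⟩
  · simp
  · cases hy <;> simp

theorem apply_le_two {x : Fin d → ℤ} (hx : x ∈ config b c d) (p : Fin d) : x p ≤ 2 := by
  have he : ∀ q : Fin d, e q p ≤ 1 := fun q => by
    by_cases h : p = q
    · rw [h, e_self]
    · rw [e_ne h]; norm_num
  rcases config_cases hx with rfl | ⟨a, y, hy, rfl⟩
  · simp
  · have h1 := he a
    cases hy with
    | zero => rw [Pi.add_apply, Pi.zero_apply]; omega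
    | pos q => have := he q; rw [Pi.add_apply]; omega
    | neg q => have := e_nonneg q p; rw [Pi.add_apply, Pi.neg_apply]; omega

theorem apply_le_one_of_coordSum_eq_zero {x : Fin d → ℤ} (hx : x ∈ config b c d)
    (h : coordSum d x = 0) (p : Fin d) : x p ≤ 1 := by
  by_contra! hp
  obtain ⟨y, hy, rfl⟩ := eq_of_apply_pos hx (p := p) (by omega)
  cases hy with
  | zero => simp at h
  | pos q => simp at h
  | neg q => have := e_nonneg q p; rw [Pi.add_apply, Pi.neg_apply, e_self] at hp; omega

/-- The values of a functional on the corners of a degenerate parallelogram are equal or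
pairwise distinct. -/
theorem apply_eq_zero_or_of_smul_add_smul_eq_zero {d : ℕ} {A B : Fin d → ℤ} {s t : ℤ} (h : s • A + t • B = 0) (hst : s ≠ 0 ∨ t ≠ 0)
    (hA : A ≠ 0) (hB : B ≠ 0) (hAB : A ≠ B) (hAB' : A + B ≠ 0) (f : (Fin d → ℤ) →+ ℤ) :
    (f A = 0 ∧ f B = 0) ∨ (f A ≠ 0 ∧ f B ≠ 0 ∧ f A ≠ f B ∧ f A + f B ≠ 0) := by
  have hs : s ≠ 0 := by
    rintro rfl
    rw [zero_smul, zero_add] at h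
    exact hst.elim (fun h => h rfl) fun ht => hB ((smul_eq_zero.1 h).resolve_left ht)
  have ht : t ≠ 0 := by
    rintro rfl
    rw [zero_smul, add_zero] at h
    exact hA ((smul_eq_zero.1 h).resolve_left hs)
  have hf : s * f A + t * f B = 0 := by
    have := congrArg f h
    rwa [map_add, map_zsmul, map_zsmul, map_zero, smul_eq_mul, smul_eq_mul] at this
  by_cases h1 : f A = 0
  · rw [h1, mul_zero, zero_add] at hf
    exact Or.inl ⟨h1, (mul_eq_zero.1 hf).resolve_left ht⟩
  refine Or.inr ⟨h1, fun h2 => ?_, fun h2 => ?_, fun h2 => ?_⟩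
  · rw [h2, mul_zero, add_zero] at hf
    exact h1 ((mul_eq_zero.1 hf).resolve_left hs)
  · have h3 : (s + t) * f A = 0 := by rw [add_mul]; nth_rewrite 2 [h2]; exact hf
    obtain rfl : t = -s := by linarith [(mul_eq_zero.1 h3).resolve_right h1]
    refine hAB (sub_eq_zero.1 ((smul_eq_zero.1 (?_ : s • (A - B) = 0)).resolve_left hs))
    rw [← h, neg_smul, smul_sub, sub_eq_add_neg]
  · obtain h2 : f B = -f A := by linarith
    rw [h2] at hf
    have h3 : (s - t) * f A = 0 := by linarith
    obtain rfl : s = t := by linarith [(mul_eq_zero.1 h3).resolve_right h1]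
    exact hAB' ((smul_eq_zero.1 (by rw [smul_add, h] : s • (A + B) = 0)).resolve_left hs)

/-- A parallelogram of four distinct points of the configuration is not degenerate. -/
theorem eq_zero_of_smul_add_smul_eq_zero {x y z w : Fin d → ℤ}
    (hx : x ∈ config b c d) (hy : y ∈ config b c d) (hz : z ∈ config b c d)
    (hw : w ∈ config b c d) (hs : x + y = z + w) (hxz : x ≠ z) (hyz : y ≠ z) (hxy : x ≠ y)
    (hzw : z ≠ w) {s t : ℤ} (h : s • (x - z) + t • (y - z) = 0) : s = 0 ∧ t = 0 := by
  by_contra hst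
  have hw' : w = x + y - z := by rw [hs]; abel
  have key := apply_eq_zero_or_of_smul_add_smul_eq_zero h (by tauto) (sub_ne_zero.2 hxz)
    (sub_ne_zero.2 hyz) (fun h => hxy (sub_left_inj.1 h)) (fun h => hzw (by
      rw [hw', ← sub_eq_zero, ← neg_eq_zero, ← h]; abel))
  -- On a degenerate parallelogram a functional is constant or takes four distinct values, and four
  -- do not fit among three consecutive integers.
  have hbound : ∀ (f : (Fin d → ℤ) →+ ℤ) (m : ℤ),
      (∀ v, v = x ∨ v = y ∨ v = z ∨ v = w → m ≤ f v ∧ f v ≤ m + 2) → f x = f z ∧ f y = f z := by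
    intro f m hf
    have h1 := hf x (by simp)
    have h2 := hf y (by simp)
    have h3 := hf z (by simp)
    have h4 := hf w (by simp)
    have h5 := key f
    have h6 : f w = f x + f y - f z := by rw [hw', map_sub, map_add]
    rw [map_sub, map_sub] at h5
    omega
  have hmem : ∀ v, v = x ∨ v = y ∨ v = z ∨ v = w → v ∈ config b c d := by
    rintro v (rfl | rfl | rfl | rfl) <;> assumption
  have hσ := hbound (coordSum d) 0 fun v hv =>
    ⟨coordSum_nonneg (hmem v hv), coordSum_le_two (hmem v hv)⟩
  have hσ' : ∀ v, v = x ∨ v = y ∨ v = z ∨ v = w → coordSum d v = coordSum d z := by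
    have h6 : coordSum d w = coordSum d x + coordSum d y - coordSum d z := by
      rw [hw', map_sub, map_add]
    rintro v (rfl | rfl | rfl | rfl)
    · exact hσ.1
    · exact hσ.2
    · rfl
    · omega
  refine hxz (funext fun p => ?_)
  -- The coordinate sum is constant on the four points. If it is 0, coordinates lie in [-1, 1]; if
  -- positive, in [0, 2]. So all coordinates are constant and x = z.
  rcases (coordSum_nonneg hz).eq_or_lt with h0 | h0
  · exact (hbound (Pi.evalAddMonoidHom (fun _ => ℤ) p) (-1) fun v hv =>
      ⟨neg_one_le_apply (hmem v hv) p,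
        apply_le_one_of_coordSum_eq_zero (hmem v hv) (by rw [hσ' v hv, ← h0]) p⟩).1
  · exact (hbound (Pi.evalAddMonoidHom (fun _ => ℤ) p) 0 fun v hv =>
      ⟨apply_nonneg_of_one_le_coordSum (hmem v hv) (by rw [hσ' v hv]; exact h0) p,
        apply_le_two (hmem v hv) p⟩).1

/-- An affine relation among `x`, `y`, `z`, `w` with a vanishing coefficient is trivial. -/
theorem affine_relation_eq_zero {x y z w : Fin d → ℤ}
    (hx : x ∈ config b c d) (hy : y ∈ config b c d) (hz : z ∈ config b c d)
    (hw : w ∈ config b c d) (hs : x + y = z + w) (hxz : x ≠ z) (hyz : y ≠ z) (hxy : x ≠ y)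
    (hzw : z ≠ w) {α β γ δ : ℤ} (hr : α • x + β • y + γ • z + δ • w = 0)
    (h0 : α + β + γ + δ = 0) (h : α = 0 ∨ β = 0 ∨ γ = 0 ∨ δ = 0) :
    α = 0 ∧ β = 0 ∧ γ = 0 ∧ δ = 0 := by
  have h1 : (α + δ) • (x - z) + (β + δ) • (y - z) = 0 := by
    rw [← hr]
    obtain rfl : γ = -(α + β + δ) := by linarith
    obtain rfl : w = x + y - z := by rw [hs]; abel
    module
  have h2 := eq_zero_of_smul_add_smul_eq_zero hx hy hz hw hs hxz hyz hxy hzw h1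
  omega

/-- The relations among a midpoint and its two distinct ends are the multiples of (2, -1, -1), which
has no zero entry. -/
theorem affine_relation_eq_zero_of_midpoint {x z w : Fin d → ℤ} (hs : x + x = z + w)
    (hxz : x ≠ z) {α γ δ : ℤ} (hr : α • x + γ • z + δ • w = 0)
    (h0 : α + γ + δ = 0) (h : α = 0 ∨ γ = 0 ∨ δ = 0) :
    α = 0 ∧ γ = 0 ∧ δ = 0 := by
  have h1 : (α + 2 * δ) • (x - z) = 0 := by
    rw [← hr]
    obtain rfl : γ = -(α + δ) := by linarith
    obtain rfl : w = x + x - z := by rw [hs]; abel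
    module
  have h2 := (smul_eq_zero.1 h1).resolve_right (sub_ne_zero.2 hxz)
  omega

end Relations

/-! ### The toric ideal -/

section Toric

open MvPolynomial

variable {K : Type*} [Field K]

theorem toricMap_monomial {m n : Type*} (A : Matrix m n ℤ) (u : n →₀ ℕ) :
    toricMap K A (monomial u 1) =
      AddMonoidAlgebra.single (Finsupp.linearCombination ℕ A.col u) 1 := by
  induction u using Finsupp.induction_linear with
  | zero => rw [monomial_zero', map_one, map_one, map_zero, AddMonoidAlgebra.one_def]
  | add u v hu hv =>
    rw [← mul_one (1 : K), ← monomial_mul, map_mul, hu, hv, AddMonoidAlgebra.single_mul_single,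
      map_add]
  | single a k =>
    simp [toricMap, aeval_monomial, AddMonoidAlgebra.single_pow]

theorem monomial_sub_monomial_mem_toricIdeal {m n : Type*} (A : Matrix m n ℤ) (u v : n →₀ ℕ) :
    monomial u (1 : K) - monomial v 1 ∈ toricIdeal K A ↔
      Finsupp.linearCombination ℕ A.col u = Finsupp.linearCombination ℕ A.col v := by
  rw [toricIdeal, RingHom.mem_ker, map_sub, sub_eq_zero, toricMap_monomial,
    toricMap_monomial]
  constructor
  · intro h
    by_contra hne
    have := congrArg (fun f => f.coeff (Finsupp.linearCombination ℕ A.col u)) h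
    simp [Ne.symm hne] at this
  · intro h
    rw [h]

/-- The toric ideal is contained in every ideal that contains its differences of monomials. -/
theorem toricIdeal_le {m n : Type*} (A : Matrix m n ℤ) (J : Ideal (MvPolynomial n K))
    (hJ : ∀ u v : n →₀ ℕ,
      Finsupp.linearCombination ℕ A.col u = Finsupp.linearCombination ℕ A.col v →
        monomial u (1 : K) - monomial v 1 ∈ J) : toricIdeal K A ≤ J := by
  classical
  -- Choosing one monomial in each fiber gives a linear map on the Laurent ring through which the
  -- quotient map by `J` factors, so the kernel of `toricMap` lies in `J`. The value 0 off the image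
  -- is arbitrary.
  let rep : (m → ℤ) → MvPolynomial n K ⧸ J := fun w =>
    if h : ∃ u, Finsupp.linearCombination ℕ A.col u = w then
      Ideal.Quotient.mk J (monomial h.choose 1) else 0
  let s : AddMonoidAlgebra K (m → ℤ) →ₗ[K] MvPolynomial n K ⧸ J :=
    Finsupp.linearCombination K rep ∘ₗ (AddMonoidAlgebra.coeffLinearEquiv K).toLinearMap
  have key : s ∘ₗ (toricMap K A).toLinearMap = (Ideal.Quotient.mkₐ K J).toLinearMap := by
    refine MvPolynomial.linearMap_ext fun u => LinearMap.ext_ring ?_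
    have h : ∃ v, Finsupp.linearCombination ℕ A.col v = Finsupp.linearCombination ℕ A.col u :=
      ⟨u, rfl⟩
    have h1 : s (toricMap K A (monomial u 1)) = Ideal.Quotient.mk J (monomial h.choose 1) := by
      rw [toricMap_monomial]
      simp [s, rep]
    exact h1.trans (Ideal.Quotient.eq.2 (hJ _ _ h.choose_spec))
  intro f hf
  have h1 := LinearMap.congr_fun key f
  have h2 : toricMap K A f = 0 := hf
  rw [← Ideal.Quotient.eq_zero_iff_mem]
  simp only [LinearMap.comp_apply, AlgHom.toLinearMap_apply, h2, map_zero] at h1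
  exact h1.symm

/-! ### Quadratic binomials are squarefree circuits -/

theorem support_monomial_sub_monomial {n : Type*} [DecidableEq n] {u v : n →₀ ℕ} (h : u ≠ v) :
    (monomial u (1 : K) - monomial v 1).support = {u, v} := by
  ext x
  simp only [mem_support_iff, coeff_sub, coeff_monomial, Finset.mem_insert, Finset.mem_singleton]
  by_cases h1 : u = x
  · subst h1; simp [h.symm]
  · by_cases h2 : v = x
    · subst h2; simp [h1]
    · simp [h1, h2, Ne.symm h1, Ne.symm h2]

theorem vars_monomial_sub_monomial {n : Type*} [DecidableEq n] {u v : n →₀ ℕ} (h : u ≠ v) :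
    (monomial u (1 : K) - monomial v 1).vars = u.support ∪ v.support := by
  ext x
  rw [mem_vars_iff_mem_support, support_monomial_sub_monomial h]
  simp

/-- Disjointness gives `u i = 0`, so the binomial is linear in the variable `i`, with coprime
monomials as coefficients. -/
theorem irreducible_monomial_sub_monomial {n : Type*} {u v : n →₀ ℕ} (h : u ≠ v)
    (hd : Disjoint u.support v.support) {i : n} (hi : v i = 1) :
    Irreducible (monomial u (1 : K) - monomial v 1) := by
  classical
  have hs := support_monomial_sub_monomial (K := K) h
  refine irreducible_of_disjoint_support (d := v) (i := i) ?_ ?_ hi ?_ fun r hr => ?_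
  · rw [hs]
    exact ⟨u, by simp, v, by simp, h⟩
  · rw [hs]; simp
  · rw [hs]
    intro a ha b hb hab
    simp only [Finset.coe_insert, Finset.coe_singleton, Set.mem_insert_iff,
      Set.mem_singleton_iff] at ha hb
    rcases ha with rfl | rfl <;> rcases hb with rfl | rfl
    · exact absurd rfl hab
    · exact hd
    · exact hd.symm
    · exact absurd rfl hab
  · have := hr u
    rw [coeff_sub, coeff_monomial, coeff_monomial, if_pos rfl, if_neg h.symm, sub_zero] at this
    exact isUnit_of_dvd_one this

theorem squarefree_monomial_pair {n : Type*} {i j : n} (h : i ≠ j) :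
    Squarefree (monomial (Finsupp.single i 1 + Finsupp.single j 1) (1 : K)) := by
  have hX : ∀ i : n, Prime (X i : MvPolynomial n K) := fun i => X_prime
  rw [← mul_one (1 : K), ← monomial_mul, squarefree_mul_iff]
  refine ⟨?_, (hX i).squarefree, (hX j).squarefree⟩
  refine ((hX i).irreducible.isRelPrime_iff_not_dvd).2 fun hd => h ?_
  exact X_dvd_X.1 hd

/-- A binomial relation gives an affine relation among the columns. -/
theorem sum_eq_zero_of_linearCombination_eq {d : ℕ} {Φ : Set (Fin d → ℤ)} {u v : Φ →₀ ℕ}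
    (h : Finsupp.linearCombination ℕ (tilde Φ).col u = Finsupp.linearCombination ℕ (tilde Φ).col v)
    (S : Finset Φ) (hu : u.support ⊆ S) (hv : v.support ⊆ S) :
    ∑ x ∈ S, ((u x : ℤ) - v x) • (x : Fin d → ℤ) = 0 ∧ ∑ x ∈ S, ((u x : ℤ) - v x) = 0 := by
  rw [Finsupp.linearCombination_apply, Finsupp.linearCombination_apply,
    Finsupp.sum_of_support_subset _ hu _ (by simp),
    Finsupp.sum_of_support_subset _ hv _ (by simp)] at h
  have hrow : ∀ r, ∑ x ∈ S, ((u x : ℤ) - v x) * tilde Φ r x = 0 := by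
    intro r
    have := congrFun h r
    simp only [Finset.sum_apply, Pi.smul_apply, Matrix.col_apply] at this
    simp only [nsmul_eq_mul] at this
    simp only [sub_mul, Finset.sum_sub_distrib, this, sub_self]
  constructor
  · funext i
    simpa [tilde, columnMatrix, Finset.sum_apply] using hrow (Sum.inl i)
  · simpa [tilde] using hrow (Sum.inr ())

end Toric

end RootToric

namespace RootToric

/-! ### Generation by quadratic circuits -/

section Generators

open MvPolynomial

variable {K : Type*} [Field K] {d : ℕ} {b c : Prop} {Φ : Set (Fin d → ℤ)}

/-- The exponent vector of the product of two variables. -/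
noncomputable abbrev pair {n : Type*} (i j : n) : n →₀ ℕ := Finsupp.single i 1 + Finsupp.single j 1

theorem support_pair {n : Type*} [DecidableEq n] (i j : n) : (pair i j).support = {i, j} := by
  ext x
  simp only [pair, Finsupp.mem_support_iff, Finsupp.add_apply, Finsupp.single_apply,
    Finset.mem_insert, Finset.mem_singleton]
  split_ifs <;> simp_all [eq_comm]

theorem linearCombination_pair (x y z w : Φ) (h : (x : Fin d → ℤ) + y = z + w) :
    Finsupp.linearCombination ℕ (tilde Φ).col (pair x y) =
      Finsupp.linearCombination ℕ (tilde Φ).col (pair z w) := by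
  simp only [pair, map_add, Finsupp.linearCombination_single, one_smul]
  funext r
  rcases r with i | r
  · simpa [tilde, columnMatrix] using congrFun h i
  · simp [tilde]

/-- A binomial relation that avoids one of the corners of a parallelogram is trivial. -/
theorem eq_of_support_ssubset [DecidableEq Φ] (hΦ : Φ ⊆ config b c d) {x y z w : Φ}
    (hs : (x : Fin d → ℤ) + y = z + w) (hxz : x ≠ z) (hxw : x ≠ w) (hyz : y ≠ z) (hyw : y ≠ w)
    (hzw : z ≠ w) {u v : Φ →₀ ℕ}
    (h : Finsupp.linearCombination ℕ (tilde Φ).col u = Finsupp.linearCombination ℕ (tilde Φ).col v)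
    (huv : u.support ∪ v.support ⊂ {x, y, z, w}) : u = v := by
  have hsub := huv.subset
  obtain ⟨t, ht, ht'⟩ := Finset.exists_of_ssubset huv
  have ht0 : (u t : ℤ) - v t = 0 := by
    simp only [Finset.mem_union, Finsupp.mem_support_iff, not_or, not_not] at ht'
    rw [ht'.1, ht'.2, sub_self]
  obtain ⟨h1, h2⟩ := sum_eq_zero_of_linearCombination_eq h {x, y, z, w}
    (Finset.union_subset_left hsub) (Finset.union_subset_right hsub)
  have hall : ∀ t ∈ ({x, y, z, w} : Finset Φ), (u t : ℤ) - v t = 0 := by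
    simp only [Finset.mem_insert, Finset.mem_singleton] at ht ⊢
    -- For x = y the parallelogram collapses to a midpoint configuration with three points, whose
    -- relations need a separate argument.
    by_cases hxy : x = y
    · subst hxy
      simp only [Finset.mem_insert, Finset.mem_singleton, true_or, Finset.insert_eq_of_mem] at h1 h2
      rw [Finset.sum_insert (by simp [hxz, hxw]), Finset.sum_insert (by simpa using hzw),
        Finset.sum_singleton] at h1 h2
      obtain ⟨h3, h4, h5⟩ := affine_relation_eq_zero_of_midpoint hs
        (fun h => hxz (Subtype.ext h)) (by rw [← h1]; abel) (by linarith)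
        (by rcases ht with rfl | rfl | rfl | rfl <;> simp [ht0])
      rintro t (rfl | rfl | rfl | rfl) <;> assumption
    · rw [Finset.sum_insert (by simp [hxy, hxz, hxw]), Finset.sum_insert (by simp [hyz, hyw]),
        Finset.sum_insert (by simpa using hzw), Finset.sum_singleton] at h1 h2
      obtain ⟨h3, h4, h5, h6⟩ := affine_relation_eq_zero (hΦ x.2) (hΦ y.2) (hΦ z.2) (hΦ w.2) hs
        (fun h => hxz (Subtype.ext h)) (fun h => hyz (Subtype.ext h))
        (fun h => hxy (Subtype.ext h)) (fun h => hzw (Subtype.ext h))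
        (by rw [← h1]; abel) (by linarith)
        (by rcases ht with rfl | rfl | rfl | rfl <;> simp [ht0])
      rintro t (rfl | rfl | rfl | rfl) <;> assumption
  ext t
  by_cases htS : t ∈ ({x, y, z, w} : Finset Φ)
  · have := hall t htS
    omega
  · have ht : t ∉ u.support ∪ v.support := fun h => htS (hsub h)
    simp only [Finset.mem_union, Finsupp.mem_support_iff, not_or, not_not] at ht
    rw [ht.1, ht.2]

/-- The quadratic squarefree circuits. -/
def quadraticCircuits (K : Type*) [Field K] (Φ : Set (Fin d → ℤ)) : Set (MvPolynomial Φ K) :=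
  {f | f ∈ squarefreeCircuits K (tilde Φ) ∧ f.IsHomogeneous 2}

theorem monomial_pair_sub_mem_quadraticCircuits (hΦ : Φ ⊆ config b c d) {x y z w : Φ}
    (hs : (x : Fin d → ℤ) + y = z + w) (hxz : x ≠ z) (hxw : x ≠ w) (hyz : y ≠ z) (hyw : y ≠ w)
    (hzw : z ≠ w) :
    monomial (pair x y) (1 : K) - monomial (pair z w) 1 ∈ quadraticCircuits K Φ := by
  classical
  have hdisj : Disjoint (pair x y).support (pair z w).support := by
    simp [support_pair, hxz.symm, hxw.symm, hyz.symm, hyw.symm]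
  have hne : pair x y ≠ pair z w := fun h => by
    rw [h, disjoint_self, support_pair] at hdisj
    simp at hdisj
  have hhom : ∀ i j : Φ, (monomial (pair i j) (1 : K)).IsHomogeneous 2 := fun i j =>
    isHomogeneous_monomial _ (by simp [pair])
  refine ⟨⟨⟨?_, ⟨_, _, hne, rfl⟩, ?_, ?_⟩, _, _, rfl, Or.inr (squarefree_monomial_pair hzw)⟩,
    (hhom x y).sub (hhom z w)⟩
  · exact (monomial_sub_monomial_mem_toricIdeal _ _ _).2 (linearCombination_pair x y z w hs)
  · exact irreducible_monomial_sub_monomial hne hdisj (i := z) (by simp [pair, hzw.symm])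
  · rintro ⟨g, hg, ⟨u, v, huv, rfl⟩, hvars⟩
    rw [vars_monomial_sub_monomial hne, vars_monomial_sub_monomial huv, support_pair,
      support_pair] at hvars
    refine huv (eq_of_support_ssubset hΦ hs hxz hxw hyz hyw hzw
      ((monomial_sub_monomial_mem_toricIdeal _ _ _).1 hg) ?_)
    convert hvars using 1
    ext t
    simp only [Finset.mem_union, Finset.mem_insert, Finset.mem_singleton, or_assoc]

theorem monomial_pair_sub_mem_span (hΦ : Φ ⊆ config b c d) (x y z w : Φ)
    (hs : (x : Fin d → ℤ) + y = z + w) :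
    monomial (pair x y) (1 : K) - monomial (pair z w) 1 ∈ Ideal.span (quadraticCircuits K Φ) := by
  by_cases hxz : x = z
  · subst hxz
    obtain rfl : y = w := Subtype.ext (add_left_cancel hs)
    simp
  by_cases hxw : x = w
  · subst hxw
    obtain rfl : y = z := Subtype.ext (add_left_cancel (hs.trans (add_comm _ _)))
    simp [pair, add_comm]
  have hyz : y ≠ z := by
    rintro rfl
    exact hxw (Subtype.ext (add_right_cancel (hs.trans (add_comm _ _))))
  have hyw : y ≠ w := by
    rintro rfl
    exact hxz (Subtype.ext (add_right_cancel hs))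
  by_cases hzw : z = w
  -- The side z = w is a square, so squarefreeness must come from x ≠ y; otherwise 2x = 2z would
  -- force x = z.
  · have hxy : x ≠ y := by
      rintro rfl
      subst hzw
      refine hxz (Subtype.ext (funext fun i => ?_))
      have := congrFun hs i
      simp only [Pi.add_apply] at this
      omega
    rw [← neg_sub]
    exact neg_mem (Ideal.subset_span (monomial_pair_sub_mem_quadraticCircuits hΦ hs.symm
      (Ne.symm hxz) hyz.symm (Ne.symm hxw) hyw.symm hxy))
  · exact Ideal.subset_span (monomial_pair_sub_mem_quadraticCircuits hΦ hs hxz hxw hyz hyw hzw)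

/-- The multiset of vectors of a monomial. -/
noncomputable def vectors (u : Φ →₀ ℕ) : Multiset (Fin d → ℤ) := (Finsupp.toMultiset u).map (↑)

open Classical in
/-- The variable of a vector, and `0` outside `Φ`. -/
noncomputable def variableOf (K : Type*) [Field K] (Φ : Set (Fin d → ℤ)) (x : Fin d → ℤ) : MvPolynomial Φ K :=
  if h : x ∈ Φ then X ⟨x, h⟩ else 0

theorem variableOf_coe (x : Φ) : variableOf K Φ x = X x := by
  simp [variableOf]

theorem prod_map_vectors (u : Φ →₀ ℕ) :
    ((vectors u).map (variableOf K Φ)).prod = monomial u 1 := by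
  induction u using Finsupp.induction_linear with
  | zero => simp [vectors]
  | add u v hu hv =>
    rw [← mul_one (1 : K), ← monomial_mul, ← hu, ← hv]
    simp [vectors]
  | single a k =>
    simp [vectors, variableOf_coe, Multiset.map_nsmul, Multiset.prod_nsmul, X_pow_eq_monomial]

theorem linearCombination_eq_vectors (u : Φ →₀ ℕ) :
    Finsupp.linearCombination ℕ (tilde Φ).col u =
      Sum.elim (vectors u).sum fun _ => ((vectors u).card : ℤ) := by
  induction u using Finsupp.induction_linear with
  | zero => funext r; rcases r with r | r <;> simp [vectors]
  | add u v hu hv =>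
    rw [map_add, hu, hv]
    funext r; rcases r with r | r <;> simp [vectors]
  | single a k =>
    funext r
    rcases r with r | r <;>
      simp [vectors, Multiset.map_nsmul, Multiset.sum_nsmul, tilde, columnMatrix]

/-- A single move contributes a quadric times the product of the untouched variables; a chain of
moves telescopes. -/
theorem Conn.prod_sub_mem_span (hΦ : Φ ⊆ config b c d) {U V : Multiset (Fin d → ℤ)}
    (h : Conn Φ U V) :
    (U.map (variableOf K Φ)).prod - (V.map (variableOf K Φ)).prod ∈
      Ideal.span (quadraticCircuits K Φ) := by
  induction h with
  | refl U => simp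
  | @step x y z w W hx hy hz hw hs =>
    have h := Ideal.mul_mem_right (W.map (variableOf K Φ)).prod _
      (monomial_pair_sub_mem_span (K := K) hΦ ⟨x, hx⟩ ⟨y, hy⟩ ⟨z, hz⟩ ⟨w, hw⟩ hs)
    convert h using 1
    have hm : ∀ i j : Φ, monomial (pair i j) (1 : K) = X i * X j := fun i j => by
      rw [X, X, monomial_mul, mul_one]
    simp only [Multiset.map_cons, Multiset.prod_cons, hm, ← variableOf_coe]
    ring
  | trans _ _ h1 h2 => simpa using add_mem h1 h2

theorem subset_config_of_eq_pos
    (hΦ : Φ = posA d ∨ Φ = posB d ∨ Φ = posC d ∨ Φ = posD d) : ∃ b c : Prop, Φ ⊆ config b c d := by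
  rcases hΦ with rfl | rfl | rfl | rfl
  · exact ⟨_, _, posA_subset_posD.trans posD_eq_config.le⟩
  · exact ⟨_, _, posB_eq_config.le⟩
  · exact ⟨_, _, posC_eq_config.le⟩
  · exact ⟨_, _, posD_eq_config.le⟩

end Generators

end RootToric

theorem corollary1p5 (K : Type*) [Field K] (d : ℕ) (hd : 2 ≤ d) (Φ : Set (Fin d → ℤ))
    (hΦ : Φ = RootToric.posA d ∨ Φ = RootToric.posB d ∨
      Φ = RootToric.posC d ∨ Φ = RootToric.posD d) :
    RootToric.toricIdeal K (RootToric.tilde Φ) =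
      Ideal.span {f | f ∈ RootToric.squarefreeCircuits K (RootToric.tilde Φ) ∧
        f.IsHomogeneous 2} := by
  obtain ⟨b, c, hsub⟩ := RootToric.subset_config_of_eq_pos hΦ
  refine le_antisymm (RootToric.toricIdeal_le _ _ fun u v h => ?_)
    (Ideal.span_le.2 fun f hf => hf.1.1.1)
  rw [RootToric.linearCombination_eq_vectors, RootToric.linearCombination_eq_vectors] at h
  have hmem : ∀ u : Φ →₀ ℕ, ∀ x ∈ RootToric.vectors u, x ∈ Φ := by
    intro u x hx
    obtain ⟨y, -, rfl⟩ := Multiset.mem_map.1 hx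
    exact y.2
  -- The row of ones yields equal cardinality, the other rows equal sum.
  have hconn := RootToric.conn_of_eq_pos hΦ (hmem u) (hmem v)
    (by simpa using congrFun h (Sum.inr ())) (funext fun i => congrFun h (Sum.inl i))
  rw [← RootToric.prod_map_vectors, ← RootToric.prod_map_vectors]
  exact hconn.prod_sub_mem_span hsub
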